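/- **Setting.** Let $\mathcal E_1,\mathcal E_2$ be real Hilbert spaces and $\mathcal E=\mathcal E_1\times\mathcal E_2$ with the canonical inner product. Let $f:\mathcal E_1\to\mathbb R$ be convex and differentiable with $\beta$-Lipschitz gradient for some $\beta>0$; let $Q=Q_1+Q_2\subset\mathcal E_2$ be nonempty, with $Q_1$ closed, convex, bounded and $Q_2$ a closed convex cone with polar cone $Q_2^\ominus$; let $K\subset\mathcal E_1$ be nonempty, closed, convex; let $A:\mathcal E_1\to\mathcal E_2$ be bounded linear and $b\in\mathcal E_2$. Write $f^*$ for the Legendre–Fenchel conjugate, $\sigma_C$ for the support function and $\iota_C$ for the $\{0,+\infty\}$-valued indicator of a set $C$, $N_C$ for its normal cone, and $\overline{\mathrm{co}}$ for the closed convex hull. Call $\mu\in\mathcal E$ admissible if $\partial f^*(\mu_1)\neq\varnothing$, $\mu_2\in Q$ and $\sigma_{-K}(\mu_1+A^*\mu_2)$ is finite; assume that an admissible point exists. Let $K^{-1}\subset K$ be compact with $-b\in\operatorname{int}\bigl(Q_2^\ominus-A\,\overline{\mathrm{co}}(K^{-1})\bigr)$; a set is called simple if it is the union of $K^{-1}$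 and a finite set. For $w_1\in\partial f^*(\mu_1')$ let $B_{f^*}(\mu_1,(\mu_1',w_1))=f^*(\mu_1)-f^*(\mu_1')-\langle\mu_1-\mu_1',w_1\rangle$. Let $\tilde f$ be the perspective of $f$, so $\tilde f(x,s)=sf(x/s)$ for $s>0$. For a compact $S\subset\mathcal E_1$ let $\mathcal M(S)$ be the space of signed Radon measures on $S$, $\mathcal M_+(S)$ the set of the nonnegative ones, and $\mathfrak E m=\int_S v\,dm(v)\in\mathcal E_1$. **Algorithm.** Fix $\lambda\in(0,1)$, an admissible $\mu^0$, $w_1^0\in\partial f^*(\mu_1^0)$, $\bar h^{-1}=+\infty$, $\bar\Delta=+\infty$. Iteration $t=0,1,\dots$: * choose $v_1^t\in-\operatorname{argmin}_{v\in K}\langle\mu_1^t+A^*\mu_2^t,v\rangle$ and put $\tilde K^t=\overline{\mathrm{co}}(K^{t-1}\cup\{-v_1^t\})$; * put $\bar h^t=\min\{\bar h^{t-1},\langle\mu_2^t,b\rangle+\langle\mu_1^t,w_1^t\rangle+\langle\mu_1^t+A^*\mu_2^t,v_1^t\rangle-f(w_1^t)\}$; * choose a minimizer $\hat x_1^t$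 of $f(x)+\sigma_Q(Ax-b)$ over $x\in\tilde K^t$, and put $\underline h^t=-f(\hat x_1^t)-\sigma_Q(A\hat x_1^t-b)$, $\Delta^t=\bar h^t-\underline h^t$, $\ell^t=\lambda\bar h^t+(1-\lambda)\underline h^t$; * if $\Delta^t<(1-\lambda)\bar\Delta$, choose a simple $K^t\subset\tilde K^t$ with $\hat x_1^t\in\overline{\mathrm{co}}(K^t)$ and set $\bar\Delta=\Delta^t$; otherwise put $K^t=K^{t-1}\cup\{-v_1^t\}$; * choose a solution $m^t$ of the problem $$(\mathrm M^t)\qquad \min_{m\in-\mathcal M_+(K^t)}\ \tilde f\bigl(-\mathfrak Em+w_1^t,\,1-m(K^t)\bigr)+\tfrac12\bigl(\|\tilde\mu_2\|^2-\operatorname{dist}(\tilde\mu_2,Q)^2\bigr)-\ell^t m(K^t),$$ where $\tilde\mu_2=-A\,\mathfrak Em+m(K^t)b+\mu_2^t$, and put $$w_1^{t+1}=\frac{w_1^t-\mathfrak Em^t}{1-m^t(K^t)},\qquad \mu_1^{t+1}=\nabla f(w_1^{t+1}),\qquad \mu_2^{t+1}=\operatorname{proj}_Q\bigl(\mu_2^t+m^t(K^t)b-A\,\mathfrak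 Em^t\bigr).$$ Let $E^t=\{(x_1,Ax_1): -x_1\in K^t\}$, $\psi(\mu)=f^*(\mu_1)+\iota_Q(\mu_2)+\langle\mu_2,b\rangle$, $Q^t=\{\mu\in\mathcal E:\psi(\mu)+\sigma_{E^t}(\mu)\le\ell^t\}$, and consider the Bregman projection problem $$(\mathrm P^t)\qquad \min_{\mu\in Q^t}\ B_{f^*}(\mu_1,(\mu_1^t,w_1^t))+\tfrac12\|\mu_2-\mu_2^t\|^2 .$$ **Proposition.** Let $t\in\mathbb N$, suppose that the algorithm has been run up to the last step of iteration $t$, and let $m^t$ be any solution of $(\mathrm M^t)$. (i) Up to a shift in value, $(\mathrm M^t)$ is the Fenchel dual of $(\mathrm P^t)$. Precisely, for $(\mu,z)\in\mathcal E\times\mathbb R$ and $\phi\in C(K^t)$ put $$F(\mu,z)=z-\langle\mu_1,w_1^t\rangle+\iota_{\operatorname{epi}f^*}(\mu_1,z)+\tfrac12\|\mu_2\|^2-\langle\mu_2,\mu_2^t\rangle+\iota_Q(\mu_2),$$ $$G(\phi)=\iota_{\{\phi-\ell^t\le0\}}(\phi),\qquad L(\mu,z)=z+\langle\mu_2,b\rangle-\langle\mu_1+A^*\mu_2,\cdot\rangle\in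 C(K^t).$$ The value of $\min_{(\mu,z)}F(\mu,z)+G(L(\mu,z))$ is the value of $(\mathrm P^t)$ plus $c=f^*(\mu_1^t)-\langle\mu_1^t,w_1^t\rangle-\frac12\|\mu_2^t\|^2=-f(w_1^t)-\frac12\|\mu_2^t\|^2$, and $(\mu,z)$ solves it if and only if $z=f^*(\mu_1)$ and $\mu$ solves $(\mathrm P^t)$. Each $m\in\mathcal M(K^t)$ defines by integration an element of $C(K^t)^*$, which determines $m$; at this element the dual objective $F^*(L^*\,\cdot)+G^*(-\,\cdot)$ equals the objective of $(\mathrm M^t)$ if $m\in-\mathcal M_+(K^t)$ and $+\infty$ otherwise, and the dual objective is $+\infty$ at every element of $C(K^t)^*$ that is not given by some $m\in-\mathcal M_+(K^t)$. Moreover $\operatorname{val}(\mathrm M^t)=-\bigl(\operatorname{val}(\mathrm P^t)+c\bigr)$. (ii) Define $w_1^{t+1},\mu^{t+1}$ from $m^t$ by the formulas above. Then: (a) $\mu^{t+1}$ is the unique solution of $(\mathrm P^t)$; (b) $w_1^{t+1}\in\partial f^*(\mu_1^{t+1})$ and $(w_1^t-w_1^{t+1},\,\mu_2^t-\mu_2^{t+1})\in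 N_{Q^t}(\mu^{t+1})$. Moreover, if along the run $\partial\sigma_E(\mu^t)\neq\varnothing$ for all $t$, where $E=\{(x_1,Ax_1):-x_1\in K\}$, and the vectors $v^t=(v_1^t,Av_1^t)$ are bounded uniformly in $t$, then $w_1^t$ is bounded uniformly in $t$. -/

import Mathlib

open MeasureTheory
open scoped Pointwise RealInnerProductSpace MeasureTheory.VectorMeasure

noncomputable section

namespace DLS

/-! ### Convex analysis with values in the extended reals -/

section Convex

open Classical in
/-- The indicator of convex analysis: `0` on `C` and `+∞` elsewhere. -/
def ind {X : Type*} (C : Set X) (x : X) : EReal := if x ∈ C then 0 else ⊤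

/-- The set of points where an extended-real-valued function is finite. -/
def effDom {X : Type*} (F : X → EReal) : Set X := {x | F x ≠ ⊥ ∧ F x ≠ ⊤}

/-- The solutions of `minimize F x` subject to `x ∈ C`. -/
def argminOn {X : Type*} (F : X → EReal) (C : Set X) : Set X := {x | x ∈ C ∧ IsMinOn F C x}

/-- The Legendre–Fenchel conjugate, a function on the topological dual. -/
def fenchelConj {X : Type*} [AddCommGroup X] [Module ℝ X] [TopologicalSpace X]
    (F : X → EReal) (φ : StrongDual ℝ X) : EReal :=
  ⨆ x : X, ((φ x : ℝ) : EReal) - F x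

/-- The objective of the Fenchel–Rockafellar primal problem: `F x + G (L x)`. -/
def fenchelPrimalObj {X Y : Type*} [AddCommGroup X] [Module ℝ X] [TopologicalSpace X]
    [AddCommGroup Y] [Module ℝ Y] [TopologicalSpace Y]
    (F : X → EReal) (G : Y → EReal) (L : X →L[ℝ] Y) (x : X) : EReal :=
  F x + G (L x)

/-- The objective of the Fenchel–Rockafellar dual problem: `F* (L* φ) + G* (-φ)`, where the
adjoint of `L` is precomposition with `L`. -/
def fenchelDualObj {X Y : Type*} [AddCommGroup X] [Module ℝ X] [TopologicalSpace X]
    [AddCommGroup Y] [Module ℝ Y] [TopologicalSpace Y] [IsTopologicalAddGroup Y]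
    (F : X → EReal) (G : Y → EReal) (L : X →L[ℝ] Y) (φ : StrongDual ℝ Y) : EReal :=
  fenchelConj F (φ.comp L) + fenchelConj G (-φ)

variable {H : Type*} [NormedAddCommGroup H] [InnerProductSpace ℝ H]

/-- The support function of `C`. -/
def supportFn (C : Set H) (μ : H) : EReal := ⨆ x ∈ C, ((⟪μ, x⟫ : ℝ) : EReal)

/-- The subdifferential of `F` at `x`. -/
def subdiff (F : H → EReal) (x : H) : Set H :=
  {g | ∀ y, F x + ((⟪g, y - x⟫ : ℝ) : EReal) ≤ F y}

/-- The normal cone of `C` at `x`, empty if `x ∉ C`. -/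
def normalCone (C : Set H) (x : H) : Set H :=
  {g | x ∈ C ∧ ∀ y ∈ C, ⟪g, y - x⟫ ≤ 0}

/-- The polar cone of `C`. -/
def polarCone (C : Set H) : Set H := {x | ∀ μ ∈ C, ⟪μ, x⟫ ≤ 0}

open Classical in
/-- The Bregman distance `B_F (μ, (μ', w))`. -/
def bregman (F : H → EReal) (μ μ' w : H) : EReal :=
  if w ∈ subdiff F μ' then F μ - F μ' - ((⟪μ - μ', w⟫ : ℝ) : EReal) else ⊤

/-- The perspective function of a real-valued `f`. -/
def perspective (f : H → ℝ) (x : H) (s : ℝ) : EReal :=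
  if 0 < s then ((s * f (s⁻¹ • x) : ℝ) : EReal)
  else if s = 0 then ⨆ y : H, ((f (y + x) - f y : ℝ) : EReal)
  else ⊤

/-- The metric projection onto `C` (a point of `C` nearest to `x`). -/
def projOn (C : Set H) (x : H) : H :=
  Classical.epsilon fun p => p ∈ C ∧ ∀ q ∈ C, ‖x - p‖ ≤ ‖x - q‖

/-- The closed convex hull. -/
def cloconv (C : Set H) : Set H := closure (convexHull ℝ C)

end Convex

/-! ### Signed measures and their averages -/

section Measures

variable {E₁ : Type*} [NormedAddCommGroup E₁] [InnerProductSpace ℝ E₁]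
  [MeasurableSpace E₁]

/-- The average `𝔈 m = ∫ v dm(v)` of a signed Borel measure on `S`. -/
def mean (S : Set E₁) (m : SignedMeasure S) : E₁ := ∫ᵛ v : S, (v : E₁) ∂<•m

/-- The functional `φ` on `C(S)` is integration against the signed measure `m`. -/
def Represents {S : Set E₁} (φ : StrongDual ℝ C(S, ℝ)) (m : SignedMeasure S) : Prop :=
  ∀ g : C(S, ℝ), φ g = ∫ᵛ v : S, g v ∂<•m

/-- On a compact set, `mean S m` is the unique vector `x` such that `⟪μ, x⟫ = ∫ ⟪μ, v⟫ dm(v)` for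
all `μ`. -/
theorem mean_unique [CompleteSpace E₁] [BorelSpace E₁] {S : Set E₁} (hS : IsCompact S)
    (m : SignedMeasure S) (x : E₁) :
    x = mean S m ↔ ∀ μ : E₁, ∫ᵛ v : S, ⟪μ, (v : E₁)⟫ ∂<•m = ⟪μ, x⟫ := by
  have : CompactSpace S := isCompact_iff_compactSpace.mp hS
  have hint : ∀ ν : Measure S, IsFiniteMeasure ν → Integrable (fun v : S => (v : E₁)) ν := by
    intro ν _
    exact continuous_subtype_val.integrable_of_hasCompactSupport
      (HasCompactSupport.of_compactSpace _)
  have key : ∀ μ : E₁, ∫ᵛ v : S, ⟪μ, (v : E₁)⟫ ∂<•m = ⟪μ, mean S m⟫ := by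
    intro μ
    set p := m.toJordanDecomposition.posPart
    set n := m.toJordanDecomposition.negPart
    have hm : m = p.toSignedMeasure - n.toSignedMeasure :=
      (SignedMeasure.toSignedMeasure_toJordanDecomposition m).symm
    have hp := hint p inferInstance
    have hn := hint n inferInstance
    have hp' : Integrable (fun v : S => ⟪μ, (v : E₁)⟫) p := hp.const_inner μ
    have hn' : Integrable (fun v : S => ⟪μ, (v : E₁)⟫) n := hn.const_inner μ
    have hv : ∀ (ν : Measure S) [IsFiniteMeasure ν], ν.toSignedMeasure.variation = ν := by
      intro ν _
      simp
    unfold mean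
    rw [hm, VectorMeasure.integral_sub_vectorMeasure, VectorMeasure.integral_sub_vectorMeasure,
      VectorMeasure.integral_toSignedMeasure, VectorMeasure.integral_toSignedMeasure,
      VectorMeasure.integral_toSignedMeasure, VectorMeasure.integral_toSignedMeasure,
      inner_sub_right, integral_inner hp, integral_inner hn]
    all_goals simpa only [VectorMeasure.Integrable, hv]
  constructor
  · rintro rfl
    exact key
  · intro h
    refine ext_inner_left ℝ fun μ => ?_
    rw [← h μ, key μ]

end Measures

/-! ### The problem and its standing assumptions -/

variable {E₁ E₂ : Type*} [NormedAddCommGroup E₁] [InnerProductSpace ℝ E₁] [CompleteSpace E₁]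
  [NormedAddCommGroup E₂] [InnerProductSpace ℝ E₂] [CompleteSpace E₂]

/-- The data of `minimize f x + σ_Q (A x - b) + ι_K x`, with `Q = Q₁ + Q₂`, and of the initial set
`Kinit` of cuts. -/
structure Problem (E₁ E₂ : Type*) [NormedAddCommGroup E₁] [InnerProductSpace ℝ E₁]
    [NormedAddCommGroup E₂] [InnerProductSpace ℝ E₂] where
  f : E₁ → ℝ
  Q₁ : Set E₂
  Q₂ : Set E₂
  K : Set E₁
  A : E₁ →L[ℝ] E₂
  b : E₂
  Kinit : Set E₁

namespace Problem

variable (P : Problem E₁ E₂)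

/-- The set `Q = Q₁ + Q₂`. -/
def Q : Set E₂ := P.Q₁ + P.Q₂

/-- The conjugate `f*`, the Hilbert space being identified with its dual. -/
def fstar (μ₁ : E₁) : EReal := fenchelConj (fun x => ((P.f x : ℝ) : EReal)) (innerSL ℝ μ₁)

/-- The linear functional `μ₁ + A* μ₂` given to the oracle. -/
def oracleDir (μ : WithLp 2 (E₁ × E₂)) : E₁ := μ.fst + ContinuousLinearMap.adjoint P.A μ.snd

/-- The set `{x | x₁ ∈ -S, x₂ = A x₁}`. -/
def graphNeg (S : Set E₁) : Set (WithLp 2 (E₁ × E₂)) := {x | -x.fst ∈ S ∧ x.snd = P.A x.fst}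

/-- The requirements on the starting point `μ⁰`. -/
def Admissible (μ : WithLp 2 (E₁ × E₂)) : Prop :=
  (subdiff P.fstar μ.fst).Nonempty ∧ μ.snd ∈ P.Q ∧
    P.oracleDir μ ∈ effDom (supportFn (-P.K))

/-- The standing assumptions, the last one being the qualification condition. -/
structure Standing : Prop where
  f_convex : ConvexOn ℝ Set.univ P.f
  f_differentiable : Differentiable ℝ P.f
  f_smooth : ∃ β : NNReal, 0 < β ∧ LipschitzWith β (gradient P.f)
  Q_nonempty : P.Q.Nonempty
  Q₁_closed : IsClosed P.Q₁
  Q₁_convex : Convex ℝ P.Q₁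
  Q₁_bounded : Bornology.IsBounded P.Q₁
  Q₂_closed : IsClosed P.Q₂
  Q₂_convex : Convex ℝ P.Q₂
  Q₂_cone : ∀ c : ℝ, 0 < c → ∀ q ∈ P.Q₂, c • q ∈ P.Q₂
  K_nonempty : P.K.Nonempty
  K_closed : IsClosed P.K
  K_convex : Convex ℝ P.K
  admissible : ∃ μ, P.Admissible μ
  Kinit_compact : IsCompact P.Kinit
  Kinit_subset : P.Kinit ⊆ P.K
  qualification : -P.b ∈ interior (polarCone P.Q₂ - P.A '' cloconv P.Kinit)

/-- A set is simple if it is the union of `Kinit` and of a finite set. -/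
def IsSimple (S : Set E₁) : Prop := ∃ J : Set E₁, J.Finite ∧ S = P.Kinit ∪ J

/-- The function `ψ(μ) = f*(μ₁) + ι_Q(μ₂) + ⟪μ₂, b⟫`. -/
def psi (μ : WithLp 2 (E₁ × E₂)) : EReal :=
  P.fstar μ.fst + ind P.Q μ.snd + ((⟪μ.snd, P.b⟫ : ℝ) : EReal)

/-! ### The projection problem

Below `μt`, `wt` are the current iterates `μᵗ`, `w₁ᵗ`, `S` is the current set of cuts `Kᵗ`, and `ℓ`
is the current level `ℓᵗ`. -/

/-- The level set `Qᵗ = {ψ + σ_{Eᵗ} ≤ ℓ}`, where `Eᵗ = {x | x₁ ∈ -S, x₂ = A x₁}`. -/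
def levelSet (S : Set E₁) (ℓ : ℝ) : Set (WithLp 2 (E₁ × E₂)) :=
  {μ | P.psi μ + supportFn (P.graphNeg S) μ ≤ (ℓ : EReal)}

/-- The objective of the Bregman projection problem; its feasible set is `levelSet`. -/
def projObj (μt : WithLp 2 (E₁ × E₂)) (wt : E₁) (μ : WithLp 2 (E₁ × E₂)) : EReal :=
  bregman P.fstar μ.fst μt.fst wt + ((1 / 2 * ‖μ.snd - μt.snd‖ ^ 2 : ℝ) : EReal)

/-- The constant by which the value of the projection problem is shifted. It equals
`f*(μ₁ᵗ) - ⟪μ₁ᵗ, wᵗ⟫ - ‖μ₂ᵗ‖² / 2`. -/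
def shift (μt : WithLp 2 (E₁ × E₂)) (wt : E₁) : ℝ := -P.f wt - 1 / 2 * ‖μt.snd‖ ^ 2

/-- The function `F` of the Fenchel–Rockafellar form of the projection problem, in the variables
`(μ, z)`, where `z` is a variable for an upper bound of `f*(μ₁)`. -/
def primalF (μt : WithLp 2 (E₁ × E₂)) (wt : E₁) (p : WithLp 2 (E₁ × E₂) × ℝ) : EReal :=
  ((p.2 - ⟪p.1.fst, wt⟫ + 1 / 2 * ‖p.1.snd‖ ^ 2 - ⟪p.1.snd, μt.snd⟫ : ℝ) : EReal)
    + ind {q : E₁ × ℝ | P.fstar q.1 ≤ (q.2 : EReal)} (p.1.fst, p.2)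
    + ind P.Q p.1.snd

/-- The operator `L` of the Fenchel–Rockafellar form of the projection problem:
`L (μ, z) = z + ⟪μ₂, b⟫ - ⟪μ₁ + A* μ₂, ·⟫`, a continuous function on `S`. -/
def primalL (S : Set E₁) : (WithLp 2 (E₁ × E₂) × ℝ) →L[ℝ] C(S, ℝ) where
  toFun p := ⟨fun v => p.2 + ⟪p.1.snd, P.b⟫ - ⟪P.oracleDir p.1, (v : E₁)⟫, by fun_prop⟩
  map_add' p q := by
    ext v
    simp [oracleDir, inner_add_left]
    ring
  map_smul' c p := by
    ext v
    simp [oracleDir, inner_add_left, inner_smul_left]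
    ring
  cont := by
    refine ContinuousMap.continuous_of_continuous_uncurry _ ?_
    have h1 : Continuous fun x : (WithLp 2 (E₁ × E₂) × ℝ) × S => x.1.1.fst :=
      (WithLp.fstL 2 ℝ E₁ E₂).continuous.comp (continuous_fst.comp continuous_fst)
    have h2 : Continuous fun x : (WithLp 2 (E₁ × E₂) × ℝ) × S => x.1.1.snd :=
      (WithLp.sndL 2 ℝ E₁ E₂).continuous.comp (continuous_fst.comp continuous_fst)
    simp only [Function.uncurry_def, oracleDir, ContinuousMap.coe_mk]
    fun_prop

section Expl

variable [MeasurableSpace E₁]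

/-- The point `μ̃₂ = -A 𝔈m + m(S) b + μ₂ᵗ`. -/
def muTilde (μt : WithLp 2 (E₁ × E₂)) (S : Set E₁) (m : SignedMeasure S) : E₂ :=
  -P.A (mean S m) + m Set.univ • P.b + μt.snd

/-- The objective of the explicit measure-valued problem; its feasible set is `{m | m ≤ 0}`. -/
def explObj (μt : WithLp 2 (E₁ × E₂)) (wt : E₁) (S : Set E₁) (ℓ : ℝ)
    (m : SignedMeasure S) : EReal :=
  perspective P.f (-mean S m + wt) (1 - m Set.univ)
    + ((1 / 2 * (‖P.muTilde μt S m‖ ^ 2 - Metric.infDist (P.muTilde μt S m) P.Q ^ 2)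
        - ℓ * m Set.univ : ℝ) : EReal)

/-- The update of `w₁`. -/
def nextW (wt : E₁) (S : Set E₁) (m : SignedMeasure S) : E₁ :=
  (1 - m Set.univ)⁻¹ • (wt - mean S m)

/-- The update of `μ`. -/
def nextMu (μt : WithLp 2 (E₁ × E₂)) (wt : E₁) (S : Set E₁) (m : SignedMeasure S) :
    WithLp 2 (E₁ × E₂) :=
  WithLp.toLp 2 (gradient P.f (nextW wt S m),
    projOn P.Q (μt.snd + m Set.univ • P.b - P.A (mean S m)))

end Expl

end Problem

/-- The function `G` of the Fenchel–Rockafellar form of the projection problem: the indicator of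
`{φ | φ - ℓ ∈ C(S; ℝ₋)}`. -/
def primalG (S : Set E₁) (ℓ : ℝ) : C(S, ℝ) → EReal := ind {φ | ∀ v, φ v - ℓ ≤ 0}

/-! ### The Dualized Level-Set algorithm -/

/-- The sequences generated by the algorithm. Here `Kprev t` is `K^{t-1}` and `gapRef t` is the
value of the reference gap at the beginning of iteration `t`. -/
structure Iterates (E₁ E₂ : Type*) [NormedAddCommGroup E₁] [InnerProductSpace ℝ E₁]
    [NormedAddCommGroup E₂] [InnerProductSpace ℝ E₂] [MeasurableSpace E₁] where
  μ : ℕ → WithLp 2 (E₁ × E₂)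
  w : ℕ → E₁
  v : ℕ → E₁
  xhat : ℕ → E₁
  hbar : ℕ → ℝ
  hlow : ℕ → ℝ
  gapRef : ℕ → EReal
  Kprev : ℕ → Set E₁
  m : ∀ t, SignedMeasure (Kprev (t + 1))

section Algorithm

variable [MeasurableSpace E₁]

/-- The set of cuts `Kᵗ`. -/
def Iterates.cuts (R : Iterates E₁ E₂) (t : ℕ) : Set E₁ := R.Kprev (t + 1)

/-- The primal-dual gap `Δᵗ`. -/
def Iterates.gap (R : Iterates E₁ E₂) (t : ℕ) : ℝ := R.hbar t - R.hlow t

/-- The level `ℓᵗ`. -/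
def Iterates.level (R : Iterates E₁ E₂) (lam : ℝ) (t : ℕ) : ℝ :=
  lam * R.hbar t + (1 - lam) * R.hlow t

/-- The set `K̃ᵗ`, the closed convex hull of `K^{t-1} ∪ {-v₁ᵗ}`. -/
def Iterates.hull (R : Iterates E₁ E₂) (t : ℕ) : Set E₁ := cloconv (R.Kprev t ∪ {-R.v t})

/-- The value of the dual cost at `μᵗ`, as it is computed in the algorithm. -/
def Iterates.dualValue (R : Iterates E₁ E₂) (P : Problem E₁ E₂) (t : ℕ) : ℝ :=
  ⟪(R.μ t).snd, P.b⟫ + ⟪(R.μ t).fst, R.w t⟫ + ⟪P.oracleDir (R.μ t), R.v t⟫ - P.f (R.w t)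

/-- `R` is a run of the Dualized Level-Set algorithm with parameter `lam` in which iteration `t` is
complete for all `t < T` and, if `T` is finite, iteration `T` is complete except for its last step
(the choice of the next dual candidate). For `T = ⊤` this is an infinite run. -/
structure IsRun (P : Problem E₁ E₂) (lam : ℝ) (R : Iterates E₁ E₂) (T : ℕ∞) : Prop where
  lam_pos : 0 < lam
  lam_lt_one : lam < 1
  init_μ : P.Admissible (R.μ 0)
  init_w : R.w 0 ∈ subdiff P.fstar (R.μ 0).fst
  init_gapRef : R.gapRef 0 = ⊤
  init_cuts : R.Kprev 0 = P.Kinit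
  /-- Oracle. -/
  oracle : ∀ t : ℕ, (t : ℕ∞) ≤ T → -R.v t ∈ P.K ∧
    ∀ x ∈ P.K, ⟪P.oracleDir (R.μ t), -R.v t⟫ ≤ ⟪P.oracleDir (R.μ t), x⟫
  /-- Dual update. -/
  hbar_zero : R.hbar 0 = R.dualValue P 0
  hbar_succ : ∀ t : ℕ, ((t + 1 : ℕ) : ℕ∞) ≤ T →
    R.hbar (t + 1) = min (R.hbar t) (R.dualValue P (t + 1))
  /-- Primal update. -/
  xhat_argmin : ∀ t : ℕ, (t : ℕ∞) ≤ T → R.xhat t ∈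
    argminOn (fun x => ((P.f x : ℝ) : EReal) + supportFn P.Q (P.A x - P.b)) (R.hull t)
  hlow_eq : ∀ t : ℕ, (t : ℕ∞) ≤ T → ((R.hlow t : ℝ) : EReal)
    = -((P.f (R.xhat t) : ℝ) : EReal) - supportFn P.Q (P.A (R.xhat t) - P.b)
  /-- Pruning. -/
  prune : ∀ t : ℕ, (t : ℕ∞) ≤ T →
    ((R.gap t : ℝ) : EReal) < ((1 - lam : ℝ) : EReal) * R.gapRef t →
    R.cuts t ⊆ R.hull t ∧ P.IsSimple (R.cuts t) ∧ R.xhat t ∈ cloconv (R.cuts t) ∧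
      R.gapRef (t + 1) = ((R.gap t : ℝ) : EReal)
  no_prune : ∀ t : ℕ, (t : ℕ∞) ≤ T →
    ¬ ((R.gap t : ℝ) : EReal) < ((1 - lam : ℝ) : EReal) * R.gapRef t →
    R.cuts t = R.Kprev t ∪ {-R.v t} ∧ R.gapRef (t + 1) = R.gapRef t
  /-- Dual candidate. -/
  candidate : ∀ t : ℕ, (t : ℕ∞) < T →
    R.m t ∈ argminOn (P.explObj (R.μ t) (R.w t) (R.cuts t) (R.level lam t)) {m | m ≤ 0}
  w_succ : ∀ t : ℕ, (t : ℕ∞) < T →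
    R.w (t + 1) = Problem.nextW (R.w t) (R.cuts t) (R.m t)
  μ_succ : ∀ t : ℕ, (t : ℕ∞) < T →
    R.μ (t + 1) = P.nextMu (R.μ t) (R.w t) (R.cuts t) (R.m t)

/-- The oracle assumption along a run: with `E = {x | x₁ ∈ -K, x₂ = A x₁}`, the subdifferential of
`σ_E` at each `μᵗ` is nonempty, and the vectors `vᵗ = (v₁ᵗ, A v₁ᵗ)` are uniformly bounded. -/
def OracleAssumption (P : Problem E₁ E₂) (R : Iterates E₁ E₂) (T : ℕ∞) : Prop :=
  (∀ t : ℕ, (t : ℕ∞) ≤ T → (subdiff (supportFn (P.graphNeg P.K)) (R.μ t)).Nonempty) ∧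
    ∃ C : ℝ, ∀ t : ℕ, (t : ℕ∞) ≤ T → ‖WithLp.toLp 2 (R.v t, P.A (R.v t))‖ ≤ C

end Algorithm

end DLS

end

open MeasureTheory DLS
open scoped RealInnerProductSpace

open MeasureTheory DLS
open scoped RealInnerProductSpace

/-! A nonpositive measure is `-ν` with `ν` finite and nonnegative, and the measure objective at `-ν`
depends only on the barycentric vector `x = ∫ v dν` and the mass `s = ν(S)`: it is `massObj` at `(x,
s)`.

The dual identification is a computation of two conjugates. The one of `primalG` at `-φ` is finite
only if `φ ≤ 0` on nonnegative functions, and then Riesz representation produces the measure. The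
one of `primalF` splits into a term in `(μ₁, z)`, which gives the perspective of `f`, and a term in
`μ₂`, which gives the squared-distance expression (`fenchelConj_primalF`,
`fenchelDualObj_eq_explObj`).

No abstract duality theorem is invoked, since a solution `-ν` is given. Perturbing `ν` by a Dirac
mass at `v` shows that the new point satisfies the cut at `v`; rescaling `ν` by `1 ± ε` gives
complementary slackness (`kkt_of_mem_argminOn`). From these conditions, integrating the cuts of any
competitor against `ν` yields the normal cone inequality (`KKT.inner_le_zero`), hence optimality
with an explicit growth term, hence uniqueness; the same conditions make the two values opposite
(`KKT.explObj_eq`).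

Boundedness holds because the next `w₁` is a weighted mean of the previous one and of points of the
cut set (`norm_nextW_le`). -/

namespace DLS

/-! ### Signed measures and functionals on `C(S)`. -/

section NonposMeasures

variable {X : Type*} [MeasurableSpace X]

lemma neg_toSignedMeasure_le_zero (ν : Measure X) [IsFiniteMeasure ν] :
    -ν.toSignedMeasure ≤ 0 := by
  intro i hi
  simp [Measure.toSignedMeasure_apply_measurable hi]

lemma exists_eq_neg_toSignedMeasure {m : SignedMeasure X} (hm : m ≤ 0) :
    ∃ ν : Measure X, ∃ _ : IsFiniteMeasure ν, m = -ν.toSignedMeasure := by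
  have h : 0 ≤[Set.univ] (-m) := by
    rw [VectorMeasure.restrict_le_restrict_iff _ _ MeasurableSet.univ]
    intro j hj _
    have := hm j hj
    simpa using this
  refine ⟨(-m).toMeasureOfZeroLE Set.univ MeasurableSet.univ h, inferInstance, ?_⟩
  have := SignedMeasure.toMeasureOfZeroLE_toSignedMeasure (-m) h
  rw [this, neg_neg]

lemma neg_toSignedMeasure_univ (ν : Measure X) [IsFiniteMeasure ν] :
    (-ν.toSignedMeasure) Set.univ = -ν.real Set.univ := by
  simp [Measure.toSignedMeasure_apply_measurable MeasurableSet.univ]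

lemma integral_neg_toSignedMeasure {G : Type*} [NormedAddCommGroup G] [NormedSpace ℝ G]
    (ν : Measure X) [IsFiniteMeasure ν] (g : X → G) :
    ∫ᵛ v, g v ∂<•(-ν.toSignedMeasure) = -∫ v, g v ∂ν := by
  rw [VectorMeasure.integral_neg_vectorMeasure, VectorMeasure.integral_toSignedMeasure]

end NonposMeasures

section CompactMeasures

variable {X : Type*} [TopologicalSpace X] [CompactSpace X] [MeasurableSpace X] [BorelSpace X]

lemma integrable_continuousMap (g : C(X, ℝ)) (ν : Measure X) [IsFiniteMeasure ν] :
    Integrable (fun v => g v) ν :=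
  g.continuous.integrable_of_hasCompactSupport (HasCompactSupport.of_compactSpace _)

lemma integral_continuousMap_signedMeasure (m : SignedMeasure X) (g : C(X, ℝ)) :
    ∫ᵛ v, g v ∂<•m = ∫ v, g v ∂m.toJordanDecomposition.posPart
      - ∫ v, g v ∂m.toJordanDecomposition.negPart := by
  have hp := integrable_continuousMap g m.toJordanDecomposition.posPart
  have hn := integrable_continuousMap g m.toJordanDecomposition.negPart
  have hv : ∀ (ν : Measure X) [IsFiniteMeasure ν], ν.toSignedMeasure.variation = ν := by
    intro ν _
    simp
  conv_lhs => rw [← SignedMeasure.toSignedMeasure_toJordanDecomposition m,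
    JordanDecomposition.toSignedMeasure]
  rw [VectorMeasure.integral_sub_vectorMeasure,
    VectorMeasure.integral_toSignedMeasure, VectorMeasure.integral_toSignedMeasure]
  all_goals simpa only [VectorMeasure.Integrable, hv]

/-- Integration against a finite measure, as a continuous linear functional. -/
noncomputable def integralDual (ν : Measure X) [IsFiniteMeasure ν] : StrongDual ℝ C(X, ℝ) :=
  LinearMap.mkContinuous
    { toFun := fun g => ∫ v, g v ∂ν
      map_add' := fun g h => by
        simpa using integral_add (integrable_continuousMap g ν) (integrable_continuousMap h ν)
      map_smul' := fun c g => by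
        simpa using integral_const_mul c (fun v => g v) }
    (ν.real Set.univ) (fun g => by
      rw [mul_comm]
      exact norm_integral_le_of_norm_le_const (Filter.Eventually.of_forall g.norm_coe_le_norm))

/-- Uniqueness is known for finite positive measures, so the Jordan parts are moved across: `p₁ +
n₂` and `p₂ + n₁` have the same integrals. -/
lemma eq_of_forall_integral_continuousMap_eq [HasOuterApproxClosed X] {m₁ m₂ : SignedMeasure X}
    (h : ∀ g : C(X, ℝ), ∫ᵛ v, g v ∂<•m₁ = ∫ᵛ v, g v ∂<•m₂) : m₁ = m₂ := by
  have key : m₁.toJordanDecomposition.posPart + m₂.toJordanDecomposition.negPart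
      = m₂.toJordanDecomposition.posPart + m₁.toJordanDecomposition.negPart := by
    refine ext_of_forall_integral_eq_of_IsFiniteMeasure fun g => ?_
    have hg := h g.toContinuousMap
    rw [integral_continuousMap_signedMeasure, integral_continuousMap_signedMeasure] at hg
    have hi := fun (ν : Measure X) (_ : IsFiniteMeasure ν) =>
      integrable_continuousMap g.toContinuousMap ν
    have e1 := integral_add_measure (hi m₁.toJordanDecomposition.posPart inferInstance)
      (hi m₂.toJordanDecomposition.negPart inferInstance)
    have e2 := integral_add_measure (hi m₂.toJordanDecomposition.posPart inferInstance)
      (hi m₁.toJordanDecomposition.negPart inferInstance)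
    refine e1.trans (Eq.trans ?_ e2.symm)
    linarith
  have hs : m₁.toJordanDecomposition.posPart.toSignedMeasure
        + m₂.toJordanDecomposition.negPart.toSignedMeasure
      = m₂.toJordanDecomposition.posPart.toSignedMeasure
        + m₁.toJordanDecomposition.negPart.toSignedMeasure := by
    rw [← Measure.toSignedMeasure_add, ← Measure.toSignedMeasure_add]
    congr 1
  rw [← SignedMeasure.toSignedMeasure_toJordanDecomposition m₁,
    ← SignedMeasure.toSignedMeasure_toJordanDecomposition m₂,
    JordanDecomposition.toSignedMeasure, JordanDecomposition.toSignedMeasure,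
    sub_eq_sub_iff_add_eq_add, hs]

/-- The Riesz representation of a positive functional on a compact space. -/
lemma exists_measure_of_nonneg [T2Space X] (φ : StrongDual ℝ C(X, ℝ))
    (hφ : ∀ g : C(X, ℝ), (∀ v, 0 ≤ g v) → 0 ≤ φ g) :
    ∃ ν : Measure X, ∃ _ : IsFiniteMeasure ν, ∀ g : C(X, ℝ), φ g = ∫ v, g v ∂ν := by
  let Λ : CompactlySupportedContinuousMap X ℝ →ₚ[ℝ] ℝ := PositiveLinearMap.mk₀
    { toFun := fun g => φ g.toContinuousMap
      map_add' := fun g h => by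
        rw [← map_add]; rfl
      map_smul' := fun c g => by
        rw [RingHom.id_apply, ← map_smul]; rfl }
    (fun g hg => hφ _ hg)
  refine ⟨RealRMK.rieszMeasure Λ, inferInstance, fun g => ?_⟩
  exact (RealRMK.integral_rieszMeasure Λ
    (CompactlySupportedContinuousMap.continuousMapEquiv g)).symm

end CompactMeasures

section Representation

variable {E₁ : Type*} [NormedAddCommGroup E₁] [MeasurableSpace E₁] {S : Set E₁}

lemma mean_neg_toSignedMeasure [InnerProductSpace ℝ E₁] (ν : Measure S) [IsFiniteMeasure ν] :
    mean S (-ν.toSignedMeasure) = -∫ v, (v : E₁) ∂ν :=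
  integral_neg_toSignedMeasure ν _

variable [BorelSpace E₁]

lemma exists_represents (hS : IsCompact S) (m : SignedMeasure S) :
    ∃ φ : StrongDual ℝ C(S, ℝ), Represents φ m := by
  have : CompactSpace S := isCompact_iff_compactSpace.mp hS
  refine ⟨integralDual m.toJordanDecomposition.posPart
    - integralDual m.toJordanDecomposition.negPart, fun g => ?_⟩
  rw [integral_continuousMap_signedMeasure]
  rfl

lemma represents_unique (hS : IsCompact S) {φ : StrongDual ℝ C(S, ℝ)} {m₁ m₂ : SignedMeasure S}
    (h₁ : Represents φ m₁) (h₂ : Represents φ m₂) : m₁ = m₂ := by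
  have : CompactSpace S := isCompact_iff_compactSpace.mp hS
  exact eq_of_forall_integral_continuousMap_eq fun g => (h₁ g).symm.trans (h₂ g)

lemma exists_represents_of_nonpos (hS : IsCompact S) {φ : StrongDual ℝ C(S, ℝ)}
    (hφ : ∀ g : C(S, ℝ), (∀ v, 0 ≤ g v) → φ g ≤ 0) :
    ∃ m : SignedMeasure S, m ≤ 0 ∧ Represents φ m := by
  have : CompactSpace S := isCompact_iff_compactSpace.mp hS
  obtain ⟨ν, _, hν⟩ := exists_measure_of_nonneg (-φ) fun g hg => by
    simpa using hφ g hg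
  refine ⟨-ν.toSignedMeasure, neg_toSignedMeasure_le_zero ν, fun g => ?_⟩
  rw [integral_neg_toSignedMeasure, ← hν]
  simp

lemma integrable_coe (hS : IsCompact S) (ν : Measure S) [IsFiniteMeasure ν] :
    Integrable (fun v : S => (v : E₁)) ν := by
  have : CompactSpace S := isCompact_iff_compactSpace.mp hS
  exact continuous_subtype_val.integrable_of_hasCompactSupport
    (HasCompactSupport.of_compactSpace _)

end Representation

/-! ### Projection onto a closed convex set and the squared distance. -/

section Projection

variable {H : Type*} [NormedAddCommGroup H] [InnerProductSpace ℝ H] [CompleteSpace H]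

lemma projOn_spec {C : Set H} (hne : C.Nonempty) (hcl : IsClosed C) (hco : Convex ℝ C) (x : H) :
    projOn C x ∈ C ∧ ∀ q ∈ C, ‖x - projOn C x‖ ≤ ‖x - q‖ := by
  obtain ⟨p, hp, hpx⟩ := exists_norm_eq_iInf_of_complete_convex hne hcl.isComplete hco x
  refine Classical.epsilon_spec (p := fun p => p ∈ C ∧ ∀ q ∈ C, ‖x - p‖ ≤ ‖x - q‖)
    ⟨p, hp, fun q hq => ?_⟩
  rw [hpx]
  exact ciInf_le ⟨0, by rintro _ ⟨w, rfl⟩; exact norm_nonneg _⟩ (⟨q, hq⟩ : C)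

lemma infDist_eq_norm_sub_projOn {C : Set H} (hne : C.Nonempty) (hcl : IsClosed C)
    (hco : Convex ℝ C) (x : H) : Metric.infDist x C = ‖x - projOn C x‖ := by
  obtain ⟨hp, hmin⟩ := projOn_spec hne hcl hco x
  apply le_antisymm
  · rw [← dist_eq_norm]
    exact Metric.infDist_le_dist_of_mem hp
  · refine (Metric.le_infDist hne).2 fun y hy => ?_
    rw [dist_eq_norm]
    exact hmin y hy

lemma inner_sub_projOn_le_zero {C : Set H} (hne : C.Nonempty) (hcl : IsClosed C)
    (hco : Convex ℝ C) (x : H) {q : H} (hq : q ∈ C) :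
    ⟪x - projOn C x, q - projOn C x⟫ ≤ 0 := by
  obtain ⟨hp, hmin⟩ := projOn_spec hne hcl hco x
  refine (norm_eq_iInf_iff_real_inner_le_zero hco hp).1 ?_ q hq
  have : Nonempty C := hne.to_subtype
  refine le_antisymm (le_ciInf fun w => hmin w w.2) ?_
  exact ciInf_le (f := fun w : C => ‖x - w‖)
    ⟨0, by rintro _ ⟨w, rfl⟩; exact norm_nonneg _⟩ ⟨projOn C x, hp⟩

/-- With `inner_sub_half_sq_le`, this says that the left side is the conjugate of `‖·‖² / 2 + ι_C`
at `y` and that the projection attains the supremum. -/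
lemma half_sq_sub_sq_infDist_eq {C : Set H} (hne : C.Nonempty) (hcl : IsClosed C)
    (hco : Convex ℝ C) (y : H) :
    1 / 2 * (‖y‖ ^ 2 - Metric.infDist y C ^ 2)
      = ⟪projOn C y, y⟫ - 1 / 2 * ‖projOn C y‖ ^ 2 := by
  rw [infDist_eq_norm_sub_projOn hne hcl hco, norm_sub_sq_real, real_inner_comm]
  ring

lemma inner_sub_half_sq_le {H : Type*} [NormedAddCommGroup H] [InnerProductSpace ℝ H]
    {C : Set H} (y : H) {q : H} (hq : q ∈ C) :
    ⟪q, y⟫ - 1 / 2 * ‖q‖ ^ 2 ≤ 1 / 2 * (‖y‖ ^ 2 - Metric.infDist y C ^ 2) := by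
  have h : Metric.infDist y C ^ 2 ≤ ‖y - q‖ ^ 2 := by
    gcongr
    · exact Metric.infDist_nonneg
    · rw [← dist_eq_norm]
      exact Metric.infDist_le_dist_of_mem hq
  rw [norm_sub_sq_real, real_inner_comm] at h
  linarith

/-- The function `(‖·‖² - dist(·, C)²) / 2` is smooth with gradient `proj_C`. -/
lemma half_sq_sub_sq_infDist_add_le {C : Set H} (hne : C.Nonempty) (hcl : IsClosed C)
    (hco : Convex ℝ C) (y h : H) :
    1 / 2 * (‖y + h‖ ^ 2 - Metric.infDist (y + h) C ^ 2)
      ≤ 1 / 2 * (‖y‖ ^ 2 - Metric.infDist y C ^ 2) + ⟪projOn C y, h⟫ + 1 / 2 * ‖h‖ ^ 2 := by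
  rw [half_sq_sub_sq_infDist_eq hne hcl hco, half_sq_sub_sq_infDist_eq hne hcl hco]
  set p := projOn C y
  set q := projOn C (y + h)
  have hq : q ∈ C := (projOn_spec hne hcl hco (y + h)).1
  -- The claim is the variational inequality for `p`, tested at `q`, plus half of the square `‖q - p
  -- - h‖²`.
  have h1 := inner_sub_projOn_le_zero hne hcl hco y hq
  have h2 : 0 ≤ ‖q - p - h‖ ^ 2 := sq_nonneg _
  rw [← real_inner_self_eq_norm_sq] at h2 ⊢
  rw [← real_inner_self_eq_norm_sq, ← real_inner_self_eq_norm_sq]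
  change ⟪y - p, q - p⟫ ≤ 0 at h1
  simp only [inner_sub_left, inner_sub_right, inner_add_right] at h1 h2 ⊢
  rw [real_inner_comm p y, real_inner_comm q y, real_inner_comm q p] at *
  rw [real_inner_comm q h, real_inner_comm p h] at h2
  linarith

end Projection

/-! ### Closedness of `Q₁ + Q₂`. -/

section SumClosed

variable {H : Type*} [NormedAddCommGroup H] [InnerProductSpace ℝ H] [CompleteSpace H]

/-- Nested nonempty closed convex bounded sets have a common point. -/
lemma exists_mem_forall_of_antitone_convex {C : ℕ → Set H} (hanti : Antitone C)
    (hne : ∀ n, (C n).Nonempty) (hcl : ∀ n, IsClosed (C n)) (hco : ∀ n, Convex ℝ (C n))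
    (hb : Bornology.IsBounded (C 0)) : ∃ x, ∀ n, x ∈ C n := by
  -- The points of least norm form a Cauchy sequence: their norms increase and are bounded, and
  -- `hdist` controls distances by differences of squared norms. This replaces weak compactness.
  have hspec := fun n => projOn_spec (hne n) (hcl n) (hco n) 0
  set x : ℕ → H := fun n => projOn (C n) 0
  have hmem : ∀ n k, n ≤ k → x k ∈ C n := fun n k hnk => hanti hnk (hspec k).1
  have hmono : Monotone fun n => ‖x n‖ ^ 2 := by
    intro n k hnk
    have := (hspec n).2 (x k) (hmem n k hnk)
    simp only [zero_sub, norm_neg] at this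
    exact pow_le_pow_left₀ (norm_nonneg _) this 2
  obtain ⟨B, hB⟩ := hb.exists_norm_le
  have hbdd : BddAbove (Set.range fun n => ‖x n‖ ^ 2) := by
    refine ⟨B ^ 2, ?_⟩
    rintro _ ⟨n, rfl⟩
    exact pow_le_pow_left₀ (norm_nonneg _) (hB _ (hmem 0 n (Nat.zero_le _))) 2
  have hdist : ∀ n k, n ≤ k → ‖x k - x n‖ ^ 2 ≤ ‖x k‖ ^ 2 - ‖x n‖ ^ 2 := by
    intro n k hnk
    have h := inner_sub_projOn_le_zero (hne n) (hcl n) (hco n) 0 (hmem n k hnk)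
    change ⟪0 - x n, x k - x n⟫ ≤ 0 at h
    rw [norm_sub_sq_real]
    simp only [zero_sub, inner_neg_left, inner_sub_right, real_inner_self_eq_norm_sq] at h
    rw [real_inner_comm]
    linarith
  have hcau := (tendsto_atTop_ciSup hmono hbdd).cauchySeq
  have hx : CauchySeq x := by
    rw [Metric.cauchySeq_iff'] at hcau ⊢
    intro ε hε
    obtain ⟨N, hN⟩ := hcau (ε ^ 2) (by positivity)
    refine ⟨N, fun n hn => ?_⟩
    have h1 := hN n hn
    rw [Real.dist_eq] at h1
    have h2 := hdist N n hn
    rw [dist_eq_norm]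
    exact lt_of_pow_lt_pow_left₀ 2 hε.le (h2.trans_lt ((le_abs_self _).trans_lt h1))
  obtain ⟨y, hy⟩ := cauchySeq_tendsto_of_complete hx
  refine ⟨y, fun n => (hcl n).mem_of_tendsto hy ?_⟩
  filter_upwards [Filter.eventually_ge_atTop n] with k hk using hmem n k hk

lemma isClosed_add_of_bounded {C D : Set H} (hC : IsClosed C) (hCc : Convex ℝ C)
    (hCb : Bornology.IsBounded C) (hD : IsClosed D) (hDc : Convex ℝ D) :
    IsClosed (C + D) := by
  refine isClosed_of_closure_subset fun y hy => ?_
  obtain ⟨δ, hδanti, hδpos, hδ⟩ := exists_seq_strictAnti_tendsto (0 : ℝ)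
  -- These are the `x ∈ C` for which `y - x` is within `δ n` of `D`. A point common to all of them
  -- splits `y` as a sum, as `D` is closed.
  let U : ℕ → Set H := fun n => C ∩ (fun x => y - x) ⁻¹' Metric.cthickening (δ n) D
  have key : ∃ x, ∀ n, x ∈ U n := by
    refine exists_mem_forall_of_antitone_convex ?_ ?_ ?_ ?_ ?_
    · intro n k hnk
      exact Set.inter_subset_inter_right _
        (Set.preimage_mono (Metric.cthickening_mono (hδanti.antitone hnk) _))
    · intro n
      obtain ⟨z, hz, hyz⟩ := Metric.mem_closure_iff.1 hy (δ n) (hδpos n)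
      obtain ⟨c, hc, d, hd, rfl⟩ := Set.mem_add.1 hz
      refine ⟨c, hc, Metric.mem_cthickening_of_dist_le _ d _ _ hd ?_⟩
      rw [dist_eq_norm] at hyz ⊢
      rw [sub_sub]
      exact hyz.le
    · exact fun n => hC.inter (Metric.isClosed_cthickening.preimage (by fun_prop))
    · intro n
      refine hCc.inter ?_
      exact (hDc.cthickening (δ n)).affine_preimage
        (AffineMap.const ℝ H y - AffineMap.id ℝ H)
    · exact hCb.subset Set.inter_subset_left
  obtain ⟨x, hx⟩ := key
  refine Set.mem_add.2 ⟨x, (hx 0).1, y - x, ?_, by abel⟩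
  rw [← hD.closure_eq, Metric.closure_eq_iInter_cthickening' D (Set.range δ)]
  · simp only [Set.mem_iInter]
    rintro _ ⟨n, rfl⟩
    exact (hx n).2
  · intro ε hε
    obtain ⟨n, hn⟩ := ((hδ.eventually (gt_mem_nhds hε))).exists
    exact ⟨δ n, ⟨n, rfl⟩, hδpos n, hn.le⟩

end SumClosed

/-! ### Gradients and subgradients of a differentiable function. -/

section Gradient

variable {H : Type*} [NormedAddCommGroup H] [InnerProductSpace ℝ H] [CompleteSpace H]

lemma hasDerivAt_comp_line {f : H → ℝ} (hf : Differentiable ℝ f) {c : ℝ → H} {c' : H} {s : ℝ}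
    (hc : HasDerivAt c c' s) : HasDerivAt (fun t => f (c t)) ⟪gradient f (c s), c'⟫ s := by
  have h := (hf (c s)).hasGradientAt.hasFDerivAt.comp_hasDerivAt s hc
  simpa [Function.comp_def] using h

lemma add_inner_gradient_le {f : H → ℝ} (hf : ConvexOn ℝ Set.univ f) (hd : Differentiable ℝ f)
    (x y : H) : f x + ⟪gradient f x, y - x⟫ ≤ f y := by
  have hl : HasDerivAt (fun t : ℝ => f (x + t • (y - x))) ⟪gradient f x, y - x⟫ 0 := by
    have hc : HasDerivAt (fun t : ℝ => x + t • (y - x)) (y - x) 0 := by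
      simpa using ((hasDerivAt_id (0 : ℝ)).smul_const (y - x)).const_add x
    simpa using hasDerivAt_comp_line hd hc
  have hcx : ConvexOn ℝ Set.univ (fun t : ℝ => f (x + t • (y - x))) := by
    have := hf.comp_affineMap (AffineMap.lineMap x y)
    simpa [Function.comp_def, AffineMap.lineMap_apply, add_comm] using this
  have h := hcx.le_slope_of_hasDerivAt (Set.mem_univ 0) (Set.mem_univ 1) zero_lt_one hl
  rw [slope_def_field] at h
  simp only [one_smul, zero_smul, add_zero, add_sub_cancel, sub_zero, div_one] at h
  linarith

/-- The gradient is the only subgradient. -/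
lemma eq_gradient_of_forall_le {f : H → ℝ} (hd : Differentiable ℝ f) {x g : H}
    (h : ∀ y, f x + ⟪g, y - x⟫ ≤ f y) : g = gradient f x := by
  have key : ∀ d : H, ⟪gradient f x - g, d⟫ = 0 := by
    intro d
    have hc : HasDerivAt (fun t : ℝ => x + t • d) d 0 := by
      simpa using ((hasDerivAt_id (0 : ℝ)).smul_const d).const_add x
    have h1 := (hasDerivAt_comp_line hd hc).sub
      (((hasDerivAt_id (0 : ℝ)).mul_const ⟪g, d⟫))
    have hmin : IsLocalMin ((fun t : ℝ => f (x + t • d)) - fun t => id t * ⟪g, d⟫) 0 := by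
      refine Filter.Eventually.of_forall fun t => ?_
      have := h (x + t • d)
      simp [inner_smul_right] at this ⊢
      linarith
    have := hmin.hasDerivAt_eq_zero h1
    simpa [inner_sub_left] using this
  have := key (gradient f x - g)
  rw [inner_self_eq_zero] at this
  exact (sub_eq_zero.1 this).symm

end Gradient

lemma iInf_mem_eq_of_mem_argminOn {X : Type*} {F : X → EReal} {C : Set X} {x : X}
    (h : x ∈ argminOn F C) : ⨅ y ∈ C, F y = F x :=
  le_antisymm (iInf₂_le x h.1) (le_iInf₂ fun _ hy => h.2 hy)

lemma iInf_eq_of_mem_argminOn_univ {X : Type*} {F : X → EReal} {x : X}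
    (h : x ∈ argminOn F Set.univ) : ⨅ y, F y = F x :=
  le_antisymm (iInf_le _ x) (le_iInf fun y => h.2 (Set.mem_univ y))

lemma ind_of_mem {X : Type*} {C : Set X} {x : X} (h : x ∈ C) : ind C x = 0 := if_pos h

lemma ind_of_notMem {X : Type*} {C : Set X} {x : X} (h : x ∉ C) : ind C x = ⊤ := if_neg h

lemma ind_ne_bot {X : Type*} (C : Set X) (x : X) : ind C x ≠ ⊥ := by
  unfold ind
  split_ifs <;> simp

lemma mem_of_ind_ne_top {X : Type*} {C : Set X} {x : X} (h : ind C x ≠ ⊤) : x ∈ C :=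
  not_imp_comm.1 ind_of_notMem h

/-- Finite sums of terms other than `-∞` have finite terms. -/
lemma ne_top_and_ne_top_of_add_ne_top {a b : EReal} (ha : a ≠ ⊥) (hb : b ≠ ⊥) (h : a + b ≠ ⊤) :
    a ≠ ⊤ ∧ b ≠ ⊤ := by
  constructor
  · rintro rfl
    exact h (EReal.top_add_of_ne_bot hb)
  · rintro rfl
    exact h (EReal.add_top_of_ne_bot ha)

lemma fenchelConj_ne_bot {X : Type*} [AddCommGroup X] [Module ℝ X] [TopologicalSpace X]
    {F : X → EReal} {x : X} (hx : F x ≠ ⊤) (φ : StrongDual ℝ X) : fenchelConj F φ ≠ ⊥ := by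
  refine fun h => ?_
  have h1 : ((φ x : ℝ) : EReal) - F x ≤ ⊥ := h ▸ le_iSup (fun y => ((φ y : ℝ) : EReal) - F y) x
  rw [le_bot_iff, sub_eq_add_neg, EReal.add_eq_bot_iff] at h1
  simp [hx] at h1

/-! ### The conjugate of `f` and the Bregman objective. -/

section Conjugate

variable {E₁ E₂ : Type*} [NormedAddCommGroup E₁] [InnerProductSpace ℝ E₁]
  [NormedAddCommGroup E₂] [InnerProductSpace ℝ E₂] (P : Problem E₁ E₂)

lemma Problem.inner_sub_le_fstar (μ x : E₁) :
    ((⟪μ, x⟫ - P.f x : ℝ) : EReal) ≤ P.fstar μ := by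
  rw [EReal.coe_sub]
  exact le_iSup (fun y => ((innerSL ℝ μ y : ℝ) : EReal) - ((P.f y : ℝ) : EReal)) x

lemma Problem.fstar_ne_bot (μ : E₁) : P.fstar μ ≠ ⊥ :=
  ne_bot_of_le_ne_bot (EReal.coe_ne_bot _) (P.inner_sub_le_fstar μ 0)

variable {P}

lemma Problem.inner_sub_le_of_fstar_le {μ : E₁} {z : ℝ} (h : P.fstar μ ≤ z) (x : E₁) :
    ⟪μ, x⟫ - P.f x ≤ z :=
  EReal.coe_le_coe_iff.1 ((P.inner_sub_le_fstar μ x).trans h)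

lemma Problem.exists_fstar_eq_of_le {μ : E₁} {z : ℝ} (h : P.fstar μ ≤ z) :
    ∃ r : ℝ, P.fstar μ = r ∧ r ≤ z := by
  have h1 : P.fstar μ ≠ ⊤ := ne_top_of_le_ne_top (EReal.coe_ne_top z) h
  refine ⟨(P.fstar μ).toReal, (EReal.coe_toReal h1 (P.fstar_ne_bot μ)).symm, ?_⟩
  rw [← EReal.coe_toReal h1 (P.fstar_ne_bot μ)] at h
  exact EReal.coe_le_coe_iff.1 h

lemma Problem.primalF_eq_coe {μt : WithLp 2 (E₁ × E₂)} {wt : E₁} {p : WithLp 2 (E₁ × E₂) × ℝ}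
    (hz : P.fstar p.1.fst ≤ p.2) (hQ : p.1.snd ∈ P.Q) :
    P.primalF μt wt p
      = ((p.2 - ⟪p.1.fst, wt⟫ + 1 / 2 * ‖p.1.snd‖ ^ 2 - ⟪p.1.snd, μt.snd⟫ : ℝ) : EReal) := by
  have h : (p.1.fst, p.2) ∈ {q : E₁ × ℝ | P.fstar q.1 ≤ (q.2 : EReal)} := hz
  rw [Problem.primalF, ind_of_mem h, ind_of_mem hQ, add_zero, add_zero]

lemma Problem.primalF_ne_bot (P : Problem E₁ E₂) (μt : WithLp 2 (E₁ × E₂)) (wt : E₁)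
    (p : WithLp 2 (E₁ × E₂) × ℝ) : P.primalF μt wt p ≠ ⊥ := by
  rw [Problem.primalF, ne_eq, EReal.add_eq_bot_iff, EReal.add_eq_bot_iff]
  simp [-EReal.coe_add, -EReal.coe_sub, ind_ne_bot]

lemma Problem.mem_of_primalF_ne_top {μt : WithLp 2 (E₁ × E₂)} {wt : E₁}
    {p : WithLp 2 (E₁ × E₂) × ℝ} (h : P.primalF μt wt p ≠ ⊤) :
    P.fstar p.1.fst ≤ p.2 ∧ p.1.snd ∈ P.Q := by
  obtain ⟨h1, h2⟩ := ne_top_and_ne_top_of_add_ne_top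
    (by
      rw [ne_eq, EReal.add_eq_bot_iff, not_or]
      exact ⟨EReal.coe_ne_bot _, ind_ne_bot _ _⟩) (ind_ne_bot _ _) h
  obtain ⟨-, h3⟩ := ne_top_and_ne_top_of_add_ne_top (EReal.coe_ne_bot _) (ind_ne_bot _ _) h1
  exact ⟨mem_of_ind_ne_top h3, mem_of_ind_ne_top h2⟩

variable [CompleteSpace E₁]

/-- Equality in Fenchel–Young makes `μ` a subgradient of `f` at `w`. This later gives uniqueness of
the first component. -/
lemma Problem.eq_gradient_of_fstar_eq (hd : Differentiable ℝ P.f) {μ w : E₁}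
    (h : P.fstar μ = ((⟪μ, w⟫ - P.f w : ℝ) : EReal)) : μ = gradient P.f w := by
  refine eq_gradient_of_forall_le hd fun y => ?_
  have := P.inner_sub_le_of_fstar_le h.le y
  rw [inner_sub_right]
  linarith

lemma Problem.fstar_gradient (hc : ConvexOn ℝ Set.univ P.f)
    (hd : Differentiable ℝ P.f) (x : E₁) :
    P.fstar (gradient P.f x) = ((⟪gradient P.f x, x⟫ - P.f x : ℝ) : EReal) := by
  refine le_antisymm (iSup_le fun y => ?_) (P.inner_sub_le_fstar _ x)
  rw [← EReal.coe_sub, EReal.coe_le_coe_iff, innerSL_apply_apply]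
  have := add_inner_gradient_le hc hd x y
  rw [inner_sub_right] at this
  linarith

lemma Problem.mem_subdiff_fstar_gradient (hc : ConvexOn ℝ Set.univ P.f)
    (hd : Differentiable ℝ P.f) (w : E₁) : w ∈ subdiff P.fstar (gradient P.f w) := by
  intro y
  rw [P.fstar_gradient hc hd, ← EReal.coe_add]
  refine le_trans (EReal.coe_le_coe_iff.2 ?_) (P.inner_sub_le_fstar y w)
  rw [inner_sub_right, real_inner_comm w, real_inner_comm w]
  linarith

/-- Testing the subgradient inequality at `gradient P.f w`, where the conjugate is known, gives the
missing half of Fenchel–Young without biconjugation. -/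
lemma Problem.fstar_eq_of_mem_subdiff (hc : ConvexOn ℝ Set.univ P.f)
    (hd : Differentiable ℝ P.f) {μ w : E₁} (h : w ∈ subdiff P.fstar μ) :
    P.fstar μ = ((⟪μ, w⟫ - P.f w : ℝ) : EReal) := by
  have h1 := h (gradient P.f w)
  rw [P.fstar_gradient hc hd] at h1
  have h2 : P.fstar μ ≠ ⊤ := by
    intro h3
    rw [h3, EReal.top_add_coe] at h1
    exact EReal.coe_ne_top _ (top_le_iff.1 h1)
  refine le_antisymm ?_ (P.inner_sub_le_fstar μ w)
  rw [← EReal.coe_toReal h2 (P.fstar_ne_bot μ)] at h1 ⊢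
  rw [← EReal.coe_add, EReal.coe_le_coe_iff, inner_sub_right, real_inner_comm,
    real_inner_comm μ] at h1
  rw [EReal.coe_le_coe_iff]
  linarith

lemma Problem.projObj_eq_coe (hc : ConvexOn ℝ Set.univ P.f) (hd : Differentiable ℝ P.f)
    {μt : WithLp 2 (E₁ × E₂)} {wt : E₁} (hw : wt ∈ subdiff P.fstar μt.fst)
    {μ : WithLp 2 (E₁ × E₂)} {r : ℝ} (hr : P.fstar μ.fst = r) :
    P.projObj μt wt μ
      = ((r - ⟪μ.fst, wt⟫ + P.f wt + 1 / 2 * ‖μ.snd - μt.snd‖ ^ 2 : ℝ) : EReal) := by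
  rw [Problem.projObj, bregman, if_pos hw, hr, P.fstar_eq_of_mem_subdiff hc hd hw,
    ← EReal.coe_sub, ← EReal.coe_sub, ← EReal.coe_add, inner_sub_left]
  congr 2
  ring

end Conjugate

/-! ### The projection problem in Fenchel–Rockafellar form. -/

section Reformulation

variable {E₁ E₂ : Type*} [NormedAddCommGroup E₁] [InnerProductSpace ℝ E₁] [CompleteSpace E₁]
  [NormedAddCommGroup E₂] [InnerProductSpace ℝ E₂] [CompleteSpace E₂] {P : Problem E₁ E₂}

lemma Problem.inner_oracleDir (μ : WithLp 2 (E₁ × E₂)) (v : E₁) :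
    ⟪P.oracleDir μ, v⟫ = ⟪μ.fst, v⟫ + ⟪μ.snd, P.A v⟫ := by
  rw [Problem.oracleDir, inner_add_left, ContinuousLinearMap.adjoint_inner_left]

lemma Problem.mem_levelSet_iff {S : Set E₁} (hS : S.Nonempty) {ℓ : ℝ}
    {μ : WithLp 2 (E₁ × E₂)} :
    μ ∈ P.levelSet S ℓ ↔ ∃ r : ℝ, P.fstar μ.fst = r ∧ μ.snd ∈ P.Q ∧
      ∀ v ∈ S, r + ⟪μ.snd, P.b⟫ - ⟪P.oracleDir μ, v⟫ ≤ ℓ := by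
  have hin : ∀ v ∈ S, ((-⟪P.oracleDir μ, v⟫ : ℝ) : EReal) ≤ supportFn (P.graphNeg S) μ := by
    intro v hv
    have hx : WithLp.toLp 2 (-v, P.A (-v)) ∈ P.graphNeg S := by
      simpa [Problem.graphNeg] using hv
    refine le_trans (le_of_eq ?_) (le_iSup₂ (f := fun x (_ : x ∈ P.graphNeg S) =>
      ((⟪μ, x⟫ : ℝ) : EReal)) _ hx)
    rw [WithLp.prod_inner_apply, Problem.inner_oracleDir]
    simp [add_comm]
  constructor
  · intro h
    change P.psi μ + supportFn (P.graphNeg S) μ ≤ (ℓ : EReal) at h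
    have hv : ∀ v ∈ S, P.psi μ + ((-⟪P.oracleDir μ, v⟫ : ℝ) : EReal) ≤ ℓ := fun v hv =>
      (add_le_add_right (hin v hv) _).trans h
    -- One cut is needed: for empty `S` the support function is `⊥`, and `⊤ + ⊥ = ⊥` would put every
    -- point in the level set.
    obtain ⟨v₀, hv₀⟩ := hS
    have hpsi : P.psi μ ≠ ⊤ := by
      intro h1
      have := hv v₀ hv₀
      rw [h1, EReal.top_add_coe] at this
      exact EReal.coe_ne_top _ (top_le_iff.1 this)
    have hQ : μ.snd ∈ P.Q := by
      by_contra hQ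
      apply hpsi
      rw [Problem.psi, ind, if_neg hQ, EReal.add_top_of_ne_bot (P.fstar_ne_bot _),
        EReal.top_add_coe]
    have hf : P.fstar μ.fst ≠ ⊤ := by
      intro h1
      apply hpsi
      rw [Problem.psi, ind, if_pos hQ, h1, add_zero, EReal.top_add_coe]
    refine ⟨(P.fstar μ.fst).toReal, (EReal.coe_toReal hf (P.fstar_ne_bot _)).symm, hQ, ?_⟩
    intro v hv'
    have h2 := hv v hv'
    rw [Problem.psi, ind, if_pos hQ, add_zero, ← EReal.coe_toReal hf (P.fstar_ne_bot _),
      ← EReal.coe_add, ← EReal.coe_add, EReal.coe_le_coe_iff] at h2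
    linarith
  · rintro ⟨r, hr, hQ, hv⟩
    change P.psi μ + supportFn (P.graphNeg S) μ ≤ (ℓ : EReal)
    have hs : supportFn (P.graphNeg S) μ ≤ ((ℓ - r - ⟪μ.snd, P.b⟫ : ℝ) : EReal) := by
      refine iSup₂_le fun x hx => ?_
      rw [EReal.coe_le_coe_iff]
      have h1 := hv _ hx.1
      rw [Problem.inner_oracleDir] at h1
      rw [WithLp.prod_inner_apply]
      have h2 : x.ofLp.2 = P.A x.fst := hx.2
      rw [h2]
      simp only [map_neg, inner_neg_right] at h1
      change ⟪μ.fst, x.fst⟫ + ⟪μ.snd, P.A x.fst⟫ ≤ _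
      linarith
    refine (add_le_add_right hs _).trans ?_
    rw [Problem.psi, ind, if_pos hQ, add_zero, hr, ← EReal.coe_add, ← EReal.coe_add,
      EReal.coe_le_coe_iff]
    linarith

lemma primalObj_eq_coe {μt : WithLp 2 (E₁ × E₂)} {wt : E₁} {S : Set E₁} {ℓ : ℝ}
    {μ : WithLp 2 (E₁ × E₂)} {z : ℝ} (hz : P.fstar μ.fst ≤ z) (hQ : μ.snd ∈ P.Q)
    (hv : ∀ v ∈ S, z + ⟪μ.snd, P.b⟫ - ⟪P.oracleDir μ, v⟫ ≤ ℓ) :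
    fenchelPrimalObj (P.primalF μt wt) (primalG S ℓ) (P.primalL S) (μ, z)
      = ((z - ⟪μ.fst, wt⟫ + 1 / 2 * ‖μ.snd‖ ^ 2 - ⟪μ.snd, μt.snd⟫ : ℝ) : EReal) := by
  have h1 : P.primalL S (μ, z) ∈ {φ : C(S, ℝ) | ∀ v, φ v - ℓ ≤ 0} := fun v =>
    sub_nonpos.2 (hv v v.2)
  rw [fenchelPrimalObj, primalG, ind_of_mem h1, add_zero]
  exact P.primalF_eq_coe hz hQ

lemma feasible_of_primalObj_ne_top {μt : WithLp 2 (E₁ × E₂)} {wt : E₁} {S : Set E₁} {ℓ : ℝ}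
    {μ : WithLp 2 (E₁ × E₂)} {z : ℝ}
    (h : fenchelPrimalObj (P.primalF μt wt) (primalG S ℓ) (P.primalL S) (μ, z) ≠ ⊤) :
    P.fstar μ.fst ≤ z ∧ μ.snd ∈ P.Q ∧
      ∀ v ∈ S, z + ⟪μ.snd, P.b⟫ - ⟪P.oracleDir μ, v⟫ ≤ ℓ := by
  obtain ⟨hF, hG⟩ := ne_top_and_ne_top_of_add_ne_top (P.primalF_ne_bot μt wt _) (ind_ne_bot _ _) h
  obtain ⟨hz, hQ⟩ := P.mem_of_primalF_ne_top hF
  exact ⟨hz, hQ, fun v hv => sub_nonpos.1 (mem_of_ind_ne_top hG ⟨v, hv⟩)⟩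

lemma primalObj_eq_projObj_add_shift (hc : ConvexOn ℝ Set.univ P.f) (hd : Differentiable ℝ P.f)
    {μt : WithLp 2 (E₁ × E₂)} {wt : E₁} (hw : wt ∈ subdiff P.fstar μt.fst)
    {S : Set E₁} (hS : S.Nonempty) {ℓ : ℝ} {μ : WithLp 2 (E₁ × E₂)} {r : ℝ}
    (hr : P.fstar μ.fst = r) (hμ : μ ∈ P.levelSet S ℓ) :
    fenchelPrimalObj (P.primalF μt wt) (primalG S ℓ) (P.primalL S) (μ, r)
      = P.projObj μt wt μ + (P.shift μt wt : EReal) := by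
  obtain ⟨r', hr', hQ, hv⟩ := (Problem.mem_levelSet_iff hS).1 hμ
  obtain rfl : r = r' := EReal.coe_eq_coe_iff.1 (hr.symm.trans hr')
  rw [primalObj_eq_coe hr.le hQ hv, P.projObj_eq_coe hc hd hw hr, ← EReal.coe_add,
    Problem.shift, norm_sub_sq_real]
  congr 1
  ring

lemma mem_argminOn_primalObj_iff (hc : ConvexOn ℝ Set.univ P.f) (hd : Differentiable ℝ P.f)
    {μt : WithLp 2 (E₁ × E₂)} {wt : E₁} (hw : wt ∈ subdiff P.fstar μt.fst)
    {S : Set E₁} (hS : S.Nonempty) {ℓ : ℝ} (hne : (P.levelSet S ℓ).Nonempty)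
    (μ : WithLp 2 (E₁ × E₂)) (z : ℝ) :
    (μ, z) ∈ argminOn
        (fenchelPrimalObj (P.primalF μt wt) (primalG S ℓ) (P.primalL S)) Set.univ ↔
      (z : EReal) = P.fstar μ.fst ∧ μ ∈ argminOn (P.projObj μt wt) (P.levelSet S ℓ) := by
  have hcancel : ∀ {a b : EReal}, a + (P.shift μt wt : EReal) ≤ b + (P.shift μt wt : EReal) →
      a ≤ b := fun h => (EReal.addLECancellable_coe _).add_le_add_iff_right.1 h
  constructor
  · rintro ⟨-, hmin⟩
    have hmin' : ∀ p, fenchelPrimalObj (P.primalF μt wt) (primalG S ℓ) (P.primalL S) (μ, z)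
        ≤ fenchelPrimalObj (P.primalF μt wt) (primalG S ℓ) (P.primalL S) p :=
      fun p => hmin (Set.mem_univ p)
    obtain ⟨ν, hν⟩ := hne
    obtain ⟨r₀, hr₀, hQ₀, hv₀⟩ := (Problem.mem_levelSet_iff hS).1 hν
    -- Without a feasible point the objective would be `⊤` everywhere and every pair would be a
    -- minimizer.
    have htop : fenchelPrimalObj (P.primalF μt wt) (primalG S ℓ) (P.primalL S) (μ, z) ≠ ⊤ := by
      refine ne_top_of_le_ne_top ?_ (hmin' (ν, r₀))
      rw [primalObj_eq_coe hr₀.le hQ₀ hv₀]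
      exact EReal.coe_ne_top _
    obtain ⟨hz, hQ, hv⟩ := feasible_of_primalObj_ne_top htop
    obtain ⟨r, hr, hrz⟩ := Problem.exists_fstar_eq_of_le hz
    have hvr : ∀ v ∈ S, r + ⟪μ.snd, P.b⟫ - ⟪P.oracleDir μ, v⟫ ≤ ℓ := fun v hv' => by
      linarith [hv v hv']
    -- Lowering `z` to the conjugate value keeps all cuts valid and lowers the objective, so a
    -- minimizer has no slack in `z`.
    have hzr : z = r := by
      have h1 := hmin' (μ, r)
      rw [primalObj_eq_coe hr.le hQ hvr, primalObj_eq_coe hz hQ hv, EReal.coe_le_coe_iff] at h1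
      linarith
    subst hzr
    have hμ : μ ∈ P.levelSet S ℓ := (Problem.mem_levelSet_iff hS).2 ⟨z, hr, hQ, hv⟩
    refine ⟨hr.symm, hμ, fun ν hν => hcancel ?_⟩
    obtain ⟨r₁, hr₁, -, -⟩ := (Problem.mem_levelSet_iff hS).1 hν
    rw [← primalObj_eq_projObj_add_shift hc hd hw hS hr hμ,
      ← primalObj_eq_projObj_add_shift hc hd hw hS hr₁ hν]
    exact hmin' _
  · rintro ⟨hz, hμ, hmin⟩
    refine ⟨Set.mem_univ _, fun p _ => ?_⟩
    obtain ⟨ν, y⟩ := p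
    by_cases htop : fenchelPrimalObj (P.primalF μt wt) (primalG S ℓ) (P.primalL S) (ν, y) = ⊤
    · exact le_top.trans_eq htop.symm
    obtain ⟨hy, hQ, hv⟩ := feasible_of_primalObj_ne_top htop
    obtain ⟨r, hr, hry⟩ := Problem.exists_fstar_eq_of_le hy
    have hvr : ∀ v ∈ S, r + ⟪ν.snd, P.b⟫ - ⟪P.oracleDir ν, v⟫ ≤ ℓ := fun v hv' => by
      linarith [hv v hv']
    have hν : ν ∈ P.levelSet S ℓ := (Problem.mem_levelSet_iff hS).2 ⟨r, hr, hQ, hvr⟩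
    have h1 : fenchelPrimalObj (P.primalF μt wt) (primalG S ℓ) (P.primalL S) (ν, r)
        ≤ fenchelPrimalObj (P.primalF μt wt) (primalG S ℓ) (P.primalL S) (ν, y) := by
      rw [primalObj_eq_coe hr.le hQ hvr, primalObj_eq_coe hy hQ hv, EReal.coe_le_coe_iff]
      linarith
    refine le_trans ?_ h1
    rw [primalObj_eq_projObj_add_shift hc hd hw hS hz.symm hμ,
      primalObj_eq_projObj_add_shift hc hd hw hS hr hν]
    exact add_le_add_left (hmin hν) _

end Reformulation

/-! ### Computation of the dual objective. -/

section ConstraintConjugate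

variable {E₁ : Type*} [NormedAddCommGroup E₁]

lemma nonpos_of_fenchelConj_primalG_ne_top {S : Set E₁} {ℓ : ℝ} {φ : StrongDual ℝ C(S, ℝ)}
    (h : fenchelConj (primalG S ℓ) (-φ) ≠ ⊤) (g : C(S, ℝ)) (hg : ∀ v, 0 ≤ g v) : φ g ≤ 0 := by
  have hle : ∀ k : C(S, ℝ), (∀ v, k v - ℓ ≤ 0) →
      (((-φ) k : ℝ) : EReal) ≤ fenchelConj (primalG S ℓ) (-φ) := by
    intro k hk
    refine le_trans (le_of_eq ?_)
      (le_iSup (fun k => (((-φ) k : ℝ) : EReal) - primalG S ℓ k) k)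
    rw [primalG, ind_of_mem (by exact hk), sub_zero]
  have hbot : fenchelConj (primalG S ℓ) (-φ) ≠ ⊥ :=
    ne_bot_of_le_ne_bot (EReal.coe_ne_bot _) (hle (ContinuousMap.const S ℓ) (by simp))
  rw [← EReal.coe_toReal h hbot] at hle
  set B := (fenchelConj (primalG S ℓ) (-φ)).toReal
  by_contra! hpos
  -- If `φ g > 0`, then `ℓ - n g` is feasible and `-φ` at it is `n φ(g) - φ(ℓ)`, which exceeds the
  -- finite supremum `B` for this `n`.
  obtain ⟨n, hn⟩ := exists_nat_gt ((B + φ (ContinuousMap.const S ℓ)) / φ g)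
  have h1 := hle (ContinuousMap.const S ℓ - (n : ℝ) • g) (fun v => by
    have := mul_nonneg (Nat.cast_nonneg (α := ℝ) n) (hg v)
    simpa using this)
  rw [EReal.coe_le_coe_iff] at h1
  simp only [neg_apply, map_sub, map_smul, smul_eq_mul] at h1
  rw [div_lt_iff₀ hpos] at hn
  linarith

variable [MeasurableSpace E₁] [BorelSpace E₁]

/-- The constant function `ℓ` is the largest feasible one, so it maximizes integration against `ν`.
-/
lemma fenchelConj_primalG_neg {S : Set E₁} (hS : IsCompact S) (ℓ : ℝ) {φ : StrongDual ℝ C(S, ℝ)}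
    {ν : Measure S} [IsFiniteMeasure ν] (hφ : ∀ g : C(S, ℝ), φ g = -∫ v, g v ∂ν) :
    fenchelConj (primalG S ℓ) (-φ) = ((ℓ * ν.real Set.univ : ℝ) : EReal) := by
  have : CompactSpace S := isCompact_iff_compactSpace.mp hS
  have hφ' : ∀ g : C(S, ℝ), (-φ) g = ∫ v, g v ∂ν := fun g => by simp [hφ]
  refine le_antisymm (iSup_le fun g => ?_) ?_
  · by_cases hg : g ∈ {φ : C(S, ℝ) | ∀ v, φ v - ℓ ≤ 0}
    · rw [primalG, ind_of_mem hg, sub_zero, EReal.coe_le_coe_iff, hφ']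
      have := integral_mono (integrable_continuousMap g ν) (integrable_const ℓ)
        (fun v => sub_nonpos.1 (hg v))
      simpa [mul_comm] using this
    · rw [primalG, ind_of_notMem hg, EReal.sub_top]
      exact bot_le
  · refine le_trans (le_of_eq ?_)
      (le_iSup (fun k => (((-φ) k : ℝ) : EReal) - primalG S ℓ k) (ContinuousMap.const S ℓ))
    rw [primalG, ind_of_mem (by simp), sub_zero, hφ']
    simp [mul_comm]

end ConstraintConjugate

section MeasureObjective

variable {E₁ E₂ : Type*} [NormedAddCommGroup E₁] [InnerProductSpace ℝ E₁]
  [NormedAddCommGroup E₂] [InnerProductSpace ℝ E₂]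

lemma perspective_ne_bot (f : E₁ → ℝ) (x : E₁) (s : ℝ) : perspective f x s ≠ ⊥ := by
  unfold perspective
  split_ifs
  · exact EReal.coe_ne_bot _
  · exact ne_bot_of_le_ne_bot (EReal.coe_ne_bot _)
      (le_iSup (fun y : E₁ => ((f (y + x) - f y : ℝ) : EReal)) 0)
  · simp

variable {P : Problem E₁ E₂}

/-- The objective of the measure-valued problem at `-ν`, as a function of the mean `x` and of the
total mass `s` of `ν`. -/
noncomputable def Problem.massObj (P : Problem E₁ E₂) (μt : WithLp 2 (E₁ × E₂)) (wt : E₁) (ℓ : ℝ)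
    (x : E₁) (s : ℝ) : ℝ :=
  (1 + s) * P.f ((1 + s)⁻¹ • (x + wt))
    + 1 / 2 * (‖P.A x - s • P.b + μt.snd‖ ^ 2
        - Metric.infDist (P.A x - s • P.b + μt.snd) P.Q ^ 2) + ℓ * s

variable [MeasurableSpace E₁]

lemma Problem.explObj_ne_bot (μt : WithLp 2 (E₁ × E₂)) (wt : E₁) (S : Set E₁) (ℓ : ℝ)
    (m : SignedMeasure S) : P.explObj μt wt S ℓ m ≠ ⊥ := by
  rw [Problem.explObj, ne_eq, EReal.add_eq_bot_iff, not_or]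
  exact ⟨perspective_ne_bot _ _ _, EReal.coe_ne_bot _⟩

lemma Problem.muTilde_neg_toSignedMeasure (μt : WithLp 2 (E₁ × E₂)) (S : Set E₁)
    (ν : Measure S) [IsFiniteMeasure ν] :
    P.muTilde μt S (-ν.toSignedMeasure)
      = P.A (∫ v, (v : E₁) ∂ν) - ν.real Set.univ • P.b + μt.snd := by
  rw [Problem.muTilde, mean_neg_toSignedMeasure, neg_toSignedMeasure_univ]
  simp [sub_eq_add_neg]

lemma Problem.explObj_neg_toSignedMeasure (μt : WithLp 2 (E₁ × E₂)) (wt : E₁) (S : Set E₁)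
    (ℓ : ℝ) (ν : Measure S) [IsFiniteMeasure ν] :
    P.explObj μt wt S ℓ (-ν.toSignedMeasure)
      = (P.massObj μt wt ℓ (∫ v, (v : E₁) ∂ν) (ν.real Set.univ) : EReal) := by
  -- Here `1 - m(S) = 1 + ν(S)`, so only the first branch of `perspective` is ever met.
  have hs : 0 < 1 + ν.real Set.univ := by positivity
  rw [Problem.explObj, Problem.muTilde_neg_toSignedMeasure, mean_neg_toSignedMeasure,
    neg_toSignedMeasure_univ, perspective, sub_neg_eq_add, if_pos hs, ← EReal.coe_add, neg_neg,
    Problem.massObj]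
  congr 1
  ring

end MeasureObjective

section Dual

variable {E₁ E₂ : Type*} [NormedAddCommGroup E₁] [InnerProductSpace ℝ E₁] [CompleteSpace E₁]
  [NormedAddCommGroup E₂] [InnerProductSpace ℝ E₂] [CompleteSpace E₂]

variable {P : Problem E₁ E₂}

lemma Problem.Standing.Q_closed (hP : P.Standing) : IsClosed P.Q :=
  isClosed_add_of_bounded hP.Q₁_closed hP.Q₁_convex hP.Q₁_bounded hP.Q₂_closed hP.Q₂_convex

lemma Problem.Standing.Q_convex (hP : P.Standing) : Convex ℝ P.Q :=
  hP.Q₁_convex.add hP.Q₂_convex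

/-- The conjugate of `F` at `L* φ`, where `φ` is integration against `-ν`. -/
lemma Problem.fenchelConj_primalF (hP : P.Standing) (μt : WithLp 2 (E₁ × E₂)) (wt : E₁)
    (ψ : StrongDual ℝ (WithLp 2 (E₁ × E₂) × ℝ)) {x : E₁} {s : ℝ} (hs : 0 ≤ s)
    (hψ : ∀ p, ψ p = -(s * (p.2 + ⟪p.1.snd, P.b⟫) - ⟪P.oracleDir p.1, x⟫)) :
    fenchelConj (P.primalF μt wt) ψ = (P.massObj μt wt 0 x s : EReal) := by
  have hs' : 0 < 1 + s := by positivity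
  -- The variables separate. The mass adds to the coefficient of `z`, and the factor `1 + s` is what
  -- produces the perspective.
  have hval : ∀ (μ : WithLp 2 (E₁ × E₂)) (z : ℝ), ψ (μ, z)
      - (z - ⟪μ.fst, wt⟫ + 1 / 2 * ‖μ.snd‖ ^ 2 - ⟪μ.snd, μt.snd⟫)
      = (1 + s) * (⟪μ.fst, (1 + s)⁻¹ • (x + wt)⟫ - z)
        + (⟪μ.snd, P.A x - s • P.b + μt.snd⟫ - 1 / 2 * ‖μ.snd‖ ^ 2) := by
    intro μ z
    rw [hψ, Problem.inner_oracleDir, mul_sub, inner_smul_right, ← mul_assoc,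
      mul_inv_cancel₀ hs'.ne']
    simp only [inner_add_right, inner_sub_right, inner_smul_right]
    ring
  refine le_antisymm (iSup_le fun p => ?_) ?_
  · by_cases htop : P.primalF μt wt p = ⊤
    · rw [htop, EReal.sub_top]
      exact bot_le
    obtain ⟨μ, z⟩ := p
    obtain ⟨hz, hQ⟩ := Problem.mem_of_primalF_ne_top htop
    rw [Problem.primalF_eq_coe hz hQ, ← EReal.coe_sub, EReal.coe_le_coe_iff]
    refine (hval μ z).trans_le ?_
    have h1 := Problem.inner_sub_le_of_fstar_le hz ((1 + s)⁻¹ • (x + wt))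
    have h2 := inner_sub_half_sq_le (P.A x - s • P.b + μt.snd) hQ
    have h3 : (1 + s) * (⟪μ.fst, (1 + s)⁻¹ • (x + wt)⟫ - z)
        ≤ (1 + s) * P.f ((1 + s)⁻¹ • (x + wt)) :=
      mul_le_mul_of_nonneg_left (by change ⟪μ.fst, _⟫ - _ ≤ z at h1; linarith) hs'.le
    rw [Problem.massObj]
    linarith
  · set y := (1 + s)⁻¹ • (x + wt) with hy
    set u := P.A x - s • P.b + μt.snd with hu
    -- The maximizers of the two separated terms; they have the form of the update `nextMu`.
    set μ : WithLp 2 (E₁ × E₂) := WithLp.toLp 2 (gradient P.f y, projOn P.Q u)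
    have hz := P.fstar_gradient hP.f_convex hP.f_differentiable y
    have hQ : μ.snd ∈ P.Q := (projOn_spec hP.Q_nonempty hP.Q_closed hP.Q_convex u).1
    refine le_trans (le_of_eq ?_) (le_iSup (fun p => ((ψ p : ℝ) : EReal) - P.primalF μt wt p)
      (μ, ⟪gradient P.f y, y⟫ - P.f y))
    rw [Problem.primalF_eq_coe (p := (μ, ⟪gradient P.f y, y⟫ - P.f y)) hz.le hQ, ← EReal.coe_sub]
    congr 1
    refine Eq.trans ?_ (hval μ _).symm
    change _ = (1 + s) * (⟪gradient P.f y, y⟫ - (⟪gradient P.f y, y⟫ - P.f y))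
      + (⟪projOn P.Q u, u⟫ - 1 / 2 * ‖projOn P.Q u‖ ^ 2)
    rw [← half_sq_sub_sq_infDist_eq hP.Q_nonempty hP.Q_closed hP.Q_convex, Problem.massObj]
    ring

lemma Problem.fenchelConj_primalF_ne_bot (hP : P.Standing) (μt : WithLp 2 (E₁ × E₂)) (wt : E₁)
    (ψ : StrongDual ℝ (WithLp 2 (E₁ × E₂) × ℝ)) : fenchelConj (P.primalF μt wt) ψ ≠ ⊥ := by
  obtain ⟨q, hq⟩ := hP.Q_nonempty
  set μ : WithLp 2 (E₁ × E₂) := WithLp.toLp 2 (gradient P.f 0, q)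
  have h : P.primalF μt wt (μ, ⟪gradient P.f 0, 0⟫ - P.f 0) ≠ ⊤ := by
    rw [Problem.primalF_eq_coe (p := (μ, ⟪gradient P.f 0, 0⟫ - P.f 0))
      (P.fstar_gradient hP.f_convex hP.f_differentiable 0).le hq]
    exact EReal.coe_ne_top _
  exact fenchelConj_ne_bot h ψ

variable [MeasurableSpace E₁] [BorelSpace E₁]

lemma exists_represents_of_dualObj_ne_top (hP : P.Standing) {μt : WithLp 2 (E₁ × E₂)} {wt : E₁}
    {S : Set E₁} (hS : IsCompact S) {ℓ : ℝ} {φ : StrongDual ℝ C(S, ℝ)}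
    (h : fenchelDualObj (P.primalF μt wt) (primalG S ℓ) (P.primalL S) φ ≠ ⊤) :
    ∃ m : SignedMeasure S, m ≤ 0 ∧ Represents φ m := by
  refine exists_represents_of_nonpos hS
    (nonpos_of_fenchelConj_primalG_ne_top (ℓ := ℓ) fun htop => ?_)
  rw [fenchelDualObj, htop, EReal.add_top_of_ne_bot (Problem.fenchelConj_primalF_ne_bot hP _ _ _)]
    at h
  exact h rfl

lemma fenchelDualObj_eq_explObj (hP : P.Standing) (μt : WithLp 2 (E₁ × E₂)) (wt : E₁)
    {S : Set E₁} (hS : IsCompact S) (ℓ : ℝ) {φ : StrongDual ℝ C(S, ℝ)} {m : SignedMeasure S}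
    (h : Represents φ m) :
    fenchelDualObj (P.primalF μt wt) (primalG S ℓ) (P.primalL S) φ
      = P.explObj μt wt S ℓ m + ind {m | m ≤ 0} m := by
  by_cases hm : m ≤ 0
  · rw [ind_of_mem (by exact hm), add_zero]
    obtain ⟨ν, _, rfl⟩ := exists_eq_neg_toSignedMeasure hm
    have hφ : ∀ g : C(S, ℝ), φ g = -∫ v, g v ∂ν := fun g => by
      rw [h g, integral_neg_toSignedMeasure]
    rw [fenchelDualObj, fenchelConj_primalG_neg hS ℓ hφ,
      Problem.fenchelConj_primalF hP μt wt (x := ∫ v, (v : E₁) ∂ν)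
        (s := ν.real Set.univ) _ measureReal_nonneg, Problem.explObj_neg_toSignedMeasure,
      ← EReal.coe_add, Problem.massObj, Problem.massObj]
    · congr 1
      ring
    · intro p
      rw [ContinuousLinearMap.comp_apply, hφ, ← integral_inner (integrable_coe hS ν)]
      have hi := (integrable_coe hS ν).const_inner (𝕜 := ℝ) (P.oracleDir p.1)
      have := integral_sub (integrable_const (μ := ν) (p.2 + ⟪p.1.snd, P.b⟫)) hi
      rw [integral_const, smul_eq_mul] at this
      rw [← this]
      rfl
  · rw [ind_of_notMem (by exact hm), EReal.add_top_of_ne_bot (Problem.explObj_ne_bot _ _ _ _ _)]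
    -- A finite dual value would give a nonpositive representing measure, which is `m` by
    -- uniqueness.
    by_contra hne
    obtain ⟨m', hm', hr⟩ := exists_represents_of_dualObj_ne_top hP hS hne
    exact hm (represents_unique hS h hr ▸ hm')

end Dual

/-! ### First order conditions for the measure problem. -/

section FirstOrder

lemma nonneg_of_hasDerivAt_of_forall_le {φ : ℝ → ℝ} {d : ℝ} (h : HasDerivAt φ d 0)
    (hmin : ∀ ε, 0 ≤ ε → ε ≤ 1 → φ 0 ≤ φ ε) : 0 ≤ d := by
  have h1 := (hasDerivAt_iff_tendsto_slope.1 h).mono_left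
    (nhdsWithin_mono (0 : ℝ) (fun x (hx : x ∈ Set.Ioi (0 : ℝ)) => ne_of_gt hx))
  refine ge_of_tendsto h1 ?_
  filter_upwards [Ioo_mem_nhdsGT (zero_lt_one (α := ℝ))] with ε hε
  rw [slope_def_field, sub_zero]
  exact div_nonneg (sub_nonneg.2 (hmin ε hε.1.le hε.2.le)) hε.1.le

variable {E₁ E₂ : Type*} [NormedAddCommGroup E₁] [InnerProductSpace ℝ E₁] [CompleteSpace E₁]
  [NormedAddCommGroup E₂] [InnerProductSpace ℝ E₂] [CompleteSpace E₂] {P : Problem E₁ E₂}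

lemma hasDerivAt_perspective {f : E₁ → ℝ} (hf : Differentiable ℝ f) (x h : E₁) {s : ℝ}
    (hs : s ≠ 0) (a : ℝ) :
    HasDerivAt (fun ε : ℝ => (s + ε * a) * f ((s + ε * a)⁻¹ • (x + ε • h)))
      (⟪gradient f (s⁻¹ • x), h⟫
        + a * (f (s⁻¹ • x) - ⟪gradient f (s⁻¹ • x), s⁻¹ • x⟫)) 0 := by
  have h1 : HasDerivAt (fun ε : ℝ => s + ε * a) a 0 := by
    simpa using ((hasDerivAt_id (0 : ℝ)).mul_const a).const_add s
  have h2 : HasDerivAt (fun ε : ℝ => x + ε • h) h 0 := by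
    simpa using ((hasDerivAt_id (0 : ℝ)).smul_const h).const_add x
  have h3 := (h1.fun_inv (by simpa using hs)).fun_smul h2
  have h4 := h1.fun_mul (hasDerivAt_comp_line hf h3)
  refine h4.congr_deriv ?_
  simp only [zero_mul, zero_smul, add_zero, inner_add_right, inner_smul_right]
  field_simp
  ring

/-- First order optimality condition for the measure-valued problem. -/
lemma Problem.massObj_first_order (hP : P.Standing) {μt : WithLp 2 (E₁ × E₂)} {wt : E₁} {ℓ : ℝ}
    {x h : E₁} {s a : ℝ} (hs : 0 ≤ s)
    (hmin : ∀ ε : ℝ, 0 ≤ ε → ε ≤ 1 →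
      P.massObj μt wt ℓ x s ≤ P.massObj μt wt ℓ (x + ε • h) (s + ε * a)) :
    0 ≤ ⟪gradient P.f ((1 + s)⁻¹ • (x + wt)), h⟫
        + a * (P.f ((1 + s)⁻¹ • (x + wt))
          - ⟪gradient P.f ((1 + s)⁻¹ • (x + wt)), (1 + s)⁻¹ • (x + wt)⟫)
        + ⟪projOn P.Q (P.A x - s • P.b + μt.snd), P.A h - a • P.b⟫ + ℓ * a := by
  have hs' : (1 + s) ≠ 0 := by positivity
  set u := P.A x - s • P.b + μt.snd with hu
  set k := P.A h - a • P.b with hk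
  set p := projOn P.Q u
  set g := 1 / 2 * (‖u‖ ^ 2 - Metric.infDist u P.Q ^ 2) with hg
  have hd := hasDerivAt_perspective hP.f_differentiable (x + wt) h hs' a
  -- The squared-distance term is replaced by its quadratic upper bound, which agrees with it at `ε
  -- = 0`. The minimum at `0` persists for this majorant, whose derivative is immediate.
  have hq : HasDerivAt (fun ε : ℝ => g + ε * ⟪p, k⟫ + 1 / 2 * (ε ^ 2 * ‖k‖ ^ 2)
      + ℓ * (s + ε * a)) (⟪p, k⟫ + ℓ * a) 0 := by
    have e1 := ((hasDerivAt_id (0 : ℝ)).mul_const ⟪p, k⟫).const_add g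
    have e2 := (((hasDerivAt_pow 2 (0 : ℝ)).mul_const (‖k‖ ^ 2)).const_mul (1 / 2))
    have e3 := (((hasDerivAt_id (0 : ℝ)).mul_const a).const_add s).const_mul ℓ
    simpa using (e1.fun_add e2).fun_add e3
  have hsum := hd.fun_add hq
  rw [← add_assoc] at hsum
  refine nonneg_of_hasDerivAt_of_forall_le hsum fun ε h0 h1 => ?_
  have hle := hmin ε h0 h1
  have hub := half_sq_sub_sq_infDist_add_le hP.Q_nonempty hP.Q_closed hP.Q_convex u (ε • k)
  have hu' : P.A (x + ε • h) - (s + ε * a) • P.b + μt.snd = u + ε • k := by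
    rw [hu, hk, map_add, map_smul, add_smul, smul_sub, mul_smul]
    abel
  rw [Problem.massObj, Problem.massObj, hu', ← hu, ← hg, ← add_assoc,
    add_right_comm x (ε • h) wt] at hle
  rw [inner_smul_right, norm_smul, mul_pow, Real.norm_eq_abs, sq_abs, ← hg] at hub
  simp only [zero_mul, zero_smul, add_zero, ne_eq, OfNat.ofNat_ne_zero, not_false_eq_true,
    zero_pow, mul_zero]
  linarith

end FirstOrder

section Optimality

variable {E₁ E₂ : Type*} [NormedAddCommGroup E₁] [InnerProductSpace ℝ E₁]
  [NormedAddCommGroup E₂] [InnerProductSpace ℝ E₂] [MeasurableSpace E₁] {P : Problem E₁ E₂}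

lemma Problem.massObj_le_of_mem_argminOn {μt : WithLp 2 (E₁ × E₂)} {wt : E₁} {S : Set E₁} {ℓ : ℝ}
    {ν : Measure S} [IsFiniteMeasure ν]
    (hν : -ν.toSignedMeasure ∈ argminOn (P.explObj μt wt S ℓ) {m | m ≤ 0})
    (ρ : Measure S) [IsFiniteMeasure ρ] :
    P.massObj μt wt ℓ (∫ v, (v : E₁) ∂ν) (ν.real Set.univ)
      ≤ P.massObj μt wt ℓ (∫ v, (v : E₁) ∂ρ) (ρ.real Set.univ) := by
  have h := hν.2 (neg_toSignedMeasure_le_zero ρ)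
  simp only [Set.mem_ofPred_eq] at h
  rwa [P.explObj_neg_toSignedMeasure, P.explObj_neg_toSignedMeasure, EReal.coe_le_coe_iff] at h

lemma Problem.massObj_le_smul {μt : WithLp 2 (E₁ × E₂)} {wt : E₁} {S : Set E₁} {ℓ : ℝ}
    {ν : Measure S} [IsFiniteMeasure ν]
    (hν : -ν.toSignedMeasure ∈ argminOn (P.explObj μt wt S ℓ) {m | m ≤ 0})
    {c : ℝ} (hc : 0 ≤ c) :
    P.massObj μt wt ℓ (∫ v, (v : E₁) ∂ν) (ν.real Set.univ)
      ≤ P.massObj μt wt ℓ (c • ∫ v, (v : E₁) ∂ν) (c * ν.real Set.univ) := by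
  have h := P.massObj_le_of_mem_argminOn hν (c.toNNReal • ν)
  rw [integral_smul_nnreal_measure] at h
  simpa [NNReal.smul_def, hc, Measure.real] using h

lemma Problem.nextW_neg_toSignedMeasure (wt : E₁) (S : Set E₁) (ν : Measure S)
    [IsFiniteMeasure ν] :
    Problem.nextW wt S (-ν.toSignedMeasure)
      = (1 + ν.real Set.univ)⁻¹ • ((∫ v, (v : E₁) ∂ν) + wt) := by
  rw [Problem.nextW, mean_neg_toSignedMeasure, neg_toSignedMeasure_univ, sub_neg_eq_add,
    sub_neg_eq_add, add_comm wt]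

variable [CompleteSpace E₁]

lemma Problem.nextMu_snd_neg_toSignedMeasure (μt : WithLp 2 (E₁ × E₂)) (wt : E₁) (S : Set E₁)
    (ν : Measure S) [IsFiniteMeasure ν] :
    (P.nextMu μt wt S (-ν.toSignedMeasure)).snd
      = projOn P.Q (P.A (∫ v, (v : E₁) ∂ν) - ν.real Set.univ • P.b + μt.snd) := by
  have h : μt.snd + (-ν.toSignedMeasure) Set.univ • P.b - P.A (mean S (-ν.toSignedMeasure))
      = P.A (∫ v, (v : E₁) ∂ν) - ν.real Set.univ • P.b + μt.snd := by
    rw [mean_neg_toSignedMeasure, neg_toSignedMeasure_univ, map_neg, neg_smul]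
    abel
  rw [← h]
  rfl

variable [BorelSpace E₁]

lemma Problem.massObj_le_add_dirac {μt : WithLp 2 (E₁ × E₂)} {wt : E₁} {S : Set E₁}
    (hS : IsCompact S) {ℓ : ℝ} {ν : Measure S} [IsFiniteMeasure ν]
    (hν : -ν.toSignedMeasure ∈ argminOn (P.explObj μt wt S ℓ) {m | m ≤ 0})
    (v : S) {ε : ℝ} (hε : 0 ≤ ε) :
    P.massObj μt wt ℓ (∫ v, (v : E₁) ∂ν) (ν.real Set.univ)
      ≤ P.massObj μt wt ℓ ((∫ v, (v : E₁) ∂ν) + ε • (v : E₁)) (ν.real Set.univ + ε * 1) := by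
  have h := P.massObj_le_of_mem_argminOn hν (ν + ε.toNNReal • Measure.dirac v)
  rw [integral_add_measure (integrable_coe hS ν) (integrable_coe hS _),
    integral_smul_nnreal_measure, integral_dirac, measureReal_add_apply] at h
  simpa [NNReal.smul_def, hε, Measure.real] using h

variable [CompleteSpace E₂]

/-- The Karush–Kuhn–Tucker conditions linking a solution `-ν` of the measure-valued problem and the
point `μ` and its subgradient `w`; `r` is the value of the conjugate at `μ`. -/
structure Problem.KKT (P : Problem E₁ E₂) (μt : WithLp 2 (E₁ × E₂)) (wt : E₁) {S : Set E₁} (ℓ : ℝ)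
    (ν : Measure S) (μ : WithLp 2 (E₁ × E₂)) (w : E₁) (r : ℝ) : Prop where
  fst_eq : μ.fst = gradient P.f w
  snd_eq : μ.snd = projOn P.Q (P.A (∫ v, (v : E₁) ∂ν) - ν.real Set.univ • P.b + μt.snd)
  w_eq : wt = (1 + ν.real Set.univ) • w - ∫ v, (v : E₁) ∂ν
  r_eq : r = ⟪μ.fst, w⟫ - P.f w
  feasible : ∀ v ∈ S, r + ⟪μ.snd, P.b⟫ - (⟪μ.fst, v⟫ + ⟪μ.snd, P.A v⟫) ≤ ℓ
  slackness : ν.real Set.univ * (r + ⟪μ.snd, P.b⟫)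
    - (⟪μ.fst, ∫ v, (v : E₁) ∂ν⟫ + ⟪μ.snd, P.A (∫ v, (v : E₁) ∂ν)⟫) = ℓ * ν.real Set.univ

/-- Only two kinds of perturbation are needed: adding a Dirac mass, a one-sided direction, yields
the cuts as inequalities; scaling, possible both ways, yields slackness as an equality. -/
lemma Problem.kkt_of_mem_argminOn (hP : P.Standing) {μt : WithLp 2 (E₁ × E₂)} {wt : E₁}
    {S : Set E₁} (hS : IsCompact S) {ℓ : ℝ} {ν : Measure S} [IsFiniteMeasure ν]
    (hν : -ν.toSignedMeasure ∈ argminOn (P.explObj μt wt S ℓ) {m | m ≤ 0}) :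
    ∃ r, P.KKT μt wt ℓ ν (P.nextMu μt wt S (-ν.toSignedMeasure))
      (Problem.nextW wt S (-ν.toSignedMeasure)) r := by
  have hM : 0 ≤ ν.real Set.univ := measureReal_nonneg
  have hw := Problem.nextW_neg_toSignedMeasure wt S ν
  have hsnd := P.nextMu_snd_neg_toSignedMeasure μt wt S ν
  have hfst : (P.nextMu μt wt S (-ν.toSignedMeasure)).fst
    = gradient P.f (Problem.nextW wt S (-ν.toSignedMeasure)) := rfl
  have hdir : ∀ (h : E₁) (a : ℝ), (∀ ε : ℝ, 0 ≤ ε → ε ≤ 1 →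
      P.massObj μt wt ℓ (∫ v, (v : E₁) ∂ν) (ν.real Set.univ)
        ≤ P.massObj μt wt ℓ ((∫ v, (v : E₁) ∂ν) + ε • h) (ν.real Set.univ + ε * a)) → _ :=
    fun h a hmin => P.massObj_first_order hP hM hmin
  simp only [← hw, ← hsnd, ← hfst] at hdir
  set w := Problem.nextW wt S (-ν.toSignedMeasure)
  set μ := P.nextMu μt wt S (-ν.toSignedMeasure)
  set x := ∫ v, (v : E₁) ∂ν
  set M := ν.real Set.univ
  refine ⟨⟪μ.fst, w⟫ - P.f w, hfst, hsnd, ?_, rfl, ?_, ?_⟩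
  · change wt = (1 + M) • w - x
    rw [hw, smul_inv_smul₀ (by positivity)]
    abel
  · intro v hv
    have := hdir v 1 fun ε h0 _ => P.massObj_le_add_dirac hS hν ⟨v, hv⟩ h0
    rw [one_smul, inner_sub_right] at this
    linarith
  · have h1 := hdir x M fun ε h0 _ => by
      have := P.massObj_le_smul hν (c := 1 + ε) (by positivity)
      rwa [add_smul, one_smul, add_mul, one_mul] at this
    -- Shrinking by `1 - ε` keeps the measure nonnegative only for `ε ≤ 1`, whence the range of `ε`
    -- in `massObj_first_order`.
    have h2 := hdir (-x) (-M) fun ε _ h1 => by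
      have := P.massObj_le_smul hν (c := 1 - ε) (by linarith)
      rw [sub_smul, one_smul, sub_mul, one_mul] at this
      rwa [smul_neg, mul_neg, ← sub_eq_add_neg, ← sub_eq_add_neg]
    simp only [map_neg, inner_neg_right, inner_sub_right, inner_smul_right] at h1 h2
    linarith

end Optimality

/-! ### Consequences of the KKT conditions. -/

section KKT

variable {E₁ E₂ : Type*} [NormedAddCommGroup E₁] [InnerProductSpace ℝ E₁] [CompleteSpace E₁]
  [NormedAddCommGroup E₂] [InnerProductSpace ℝ E₂] [CompleteSpace E₂] [MeasurableSpace E₁]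
  {P : Problem E₁ E₂}
  {μt : WithLp 2 (E₁ × E₂)} {wt : E₁} {S : Set E₁} {ℓ : ℝ} {ν : Measure S}
  {μ' : WithLp 2 (E₁ × E₂)} {w' : E₁} {r' : ℝ}

lemma Problem.KKT.fstar_eq (hk : P.KKT μt wt ℓ ν μ' w' r') (hP : P.Standing) :
    P.fstar μ'.fst = r' := by
  rw [hk.r_eq, hk.fst_eq]
  exact P.fstar_gradient hP.f_convex hP.f_differentiable w'

lemma Problem.KKT.mem_levelSet (hk : P.KKT μt wt ℓ ν μ' w' r') (hP : P.Standing)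
    (hne : S.Nonempty) : μ' ∈ P.levelSet S ℓ := by
  refine (Problem.mem_levelSet_iff hne).2 ⟨r', hk.fstar_eq hP, ?_, fun v hv => ?_⟩
  · rw [hk.snd_eq]
    exact (projOn_spec hP.Q_nonempty hP.Q_closed hP.Q_convex _).1
  · rw [Problem.inner_oracleDir]
    exact hk.feasible v hv

/-- The absence of a duality gap is checked by substitution: slackness cancels the level term, and
the projection formula evaluates the distance term. -/
lemma Problem.KKT.explObj_eq (hk : P.KKT μt wt ℓ ν μ' w' r') (hP : P.Standing)
    (hw : wt ∈ subdiff P.fstar μt.fst) [IsFiniteMeasure ν] :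
    P.explObj μt wt S ℓ (-ν.toSignedMeasure)
      = -(P.projObj μt wt μ' + (P.shift μt wt : EReal)) := by
  have hM : (1 + ν.real Set.univ) ≠ 0 := by positivity
  rw [P.explObj_neg_toSignedMeasure,
    P.projObj_eq_coe hP.f_convex hP.f_differentiable hw (hk.fstar_eq hP), ← EReal.coe_add,
    ← EReal.coe_neg, Problem.massObj,
    half_sq_sub_sq_infDist_eq hP.Q_nonempty hP.Q_closed hP.Q_convex, ← hk.snd_eq, Problem.shift]
  congr 1
  have h4 := hk.slackness
  have h5 := hk.r_eq
  have hx : (1 + ν.real Set.univ)⁻¹ • ((∫ v, (v : E₁) ∂ν) + wt) = w' := by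
    rw [hk.w_eq, add_sub_cancel, inv_smul_smul₀ hM]
  have hwt : ⟪μ'.fst, wt⟫ = (1 + ν.real Set.univ) * ⟪μ'.fst, w'⟫
      - ⟪μ'.fst, ∫ v, (v : E₁) ∂ν⟫ := by
    rw [hk.w_eq, inner_sub_right, inner_smul_right]
  rw [hx, hwt, norm_sub_sq_real]
  simp only [inner_add_right, inner_sub_right, inner_smul_right]
  subst h5
  linarith

variable [BorelSpace E₁]

lemma Problem.integral_constraint_le (hS : IsCompact S) [IsFiniteMeasure ν]
    {μ : WithLp 2 (E₁ × E₂)} {r : ℝ}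
    (hv : ∀ v ∈ S, r + ⟪μ.snd, P.b⟫ - ⟪P.oracleDir μ, v⟫ ≤ ℓ) :
    ν.real Set.univ * (r + ⟪μ.snd, P.b⟫)
      - (⟪μ.fst, ∫ v, (v : E₁) ∂ν⟫ + ⟪μ.snd, P.A (∫ v, (v : E₁) ∂ν)⟫)
      ≤ ℓ * ν.real Set.univ := by
  have hi := (integrable_coe hS ν).const_inner (𝕜 := ℝ) (P.oracleDir μ)
  have h := integral_mono ((integrable_const (r + ⟪μ.snd, P.b⟫)).sub hi) (integrable_const ℓ)
    (fun v : S => hv v v.2)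
  have e := integral_sub (integrable_const (μ := ν) (r + ⟪μ.snd, P.b⟫)) hi
  rw [integral_inner (integrable_coe hS ν), integral_const, smul_eq_mul,
    Problem.inner_oracleDir] at e
  rw [integral_const, smul_eq_mul, mul_comm _ ℓ] at h
  exact e.symm.trans_le h

/-- Since `wt - w' = M w' - x`, the inequality is a sum of three: the cuts of `μ` integrated against
`ν` minus slackness, `M` times Fenchel–Young at `w'`, and the variational inequality of the
projection. -/
lemma Problem.KKT.inner_le_zero (hk : P.KKT μt wt ℓ ν μ' w' r') (hP : P.Standing)
    (hS : IsCompact S) (hne : S.Nonempty) [IsFiniteMeasure ν] {μ : WithLp 2 (E₁ × E₂)}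
    (hμ : μ ∈ P.levelSet S ℓ) :
    ⟪wt - w', μ.fst - μ'.fst⟫ + ⟪μt.snd - μ'.snd, μ.snd - μ'.snd⟫ ≤ 0 := by
  obtain ⟨r, hr, hQ, hv⟩ := (Problem.mem_levelSet_iff hne).1 hμ
  have hM : 0 ≤ ν.real Set.univ := measureReal_nonneg
  have h1 := Problem.integral_constraint_le hS (ν := ν) hv
  have h2 := inner_sub_projOn_le_zero hP.Q_nonempty hP.Q_closed hP.Q_convex
    (P.A (∫ v, (v : E₁) ∂ν) - ν.real Set.univ • P.b + μt.snd) hQ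
  rw [← hk.snd_eq] at h2
  have h3 := mul_le_mul_of_nonneg_left (P.inner_sub_le_of_fstar_le hr.le w') hM
  have h4 := hk.slackness
  have h5 := hk.r_eq
  rw [hk.w_eq]
  set x := ∫ v, (v : E₁) ∂ν
  set M := ν.real Set.univ
  have hw : (1 + M) • w' - x - w' = M • w' - x := by
    rw [add_smul, one_smul]
    abel
  rw [hw]
  rw [show P.A x - M • P.b + μt.snd - μ'.snd = P.A x - M • P.b + (μt.snd - μ'.snd) by abel,
    inner_add_left] at h2
  subst h5
  rw [inner_sub_left (P.A x), inner_sub_right, inner_sub_right (M • P.b)] at h2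
  rw [inner_sub_left (M • w'), inner_sub_right (M • w'), inner_sub_right x]
  simp only [real_inner_smul_left, real_inner_comm _ (P.A x), real_inner_comm _ P.b,
    real_inner_comm _ x, real_inner_comm _ w'] at *
  linarith

/-- The growth of the objective of the projection problem away from its solution. -/
lemma Problem.KKT.growth (hk : P.KKT μt wt ℓ ν μ' w' r') (hP : P.Standing)
    (hS : IsCompact S) (hne : S.Nonempty) [IsFiniteMeasure ν] {μ : WithLp 2 (E₁ × E₂)} {r : ℝ}
    (hμ : μ ∈ P.levelSet S ℓ) :
    r' - ⟪μ'.fst, wt⟫ + P.f wt + 1 / 2 * ‖μ'.snd - μt.snd‖ ^ 2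
        + (r - (⟪μ.fst, w'⟫ - P.f w')) + 1 / 2 * ‖μ.snd - μ'.snd‖ ^ 2
      ≤ r - ⟪μ.fst, wt⟫ + P.f wt + 1 / 2 * ‖μ.snd - μt.snd‖ ^ 2 := by
  have h := hk.inner_le_zero hP hS hne hμ
  rw [hk.r_eq]
  have e : ‖μ.snd - μt.snd‖ ^ 2 = ‖μ.snd - μ'.snd‖ ^ 2
      - 2 * ⟪μt.snd - μ'.snd, μ.snd - μ'.snd⟫ + ‖μ'.snd - μt.snd‖ ^ 2 := by
    rw [show μ.snd - μt.snd = (μ.snd - μ'.snd) - (μt.snd - μ'.snd) by abel, norm_sub_sq_real,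
      real_inner_comm, norm_sub_rev μt.snd]
  rw [real_inner_comm (μ.fst - μ'.fst), inner_sub_left (μ.fst), inner_sub_right (μ.fst),
    inner_sub_right (μ'.fst)] at h
  rw [e]
  linarith

/-- For another minimizer both surplus terms in `growth` vanish: the square identifies `μ₂`, and
equality in Fenchel–Young at `w'` identifies `μ₁`. -/
lemma Problem.KKT.argminOn_projObj (hk : P.KKT μt wt ℓ ν μ' w' r') (hP : P.Standing)
    (hw : wt ∈ subdiff P.fstar μt.fst) (hS : IsCompact S) (hne : S.Nonempty)
    [IsFiniteMeasure ν] : argminOn (P.projObj μt wt) (P.levelSet S ℓ) = {μ'} := by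
  have hobj : ∀ {μ : WithLp 2 (E₁ × E₂)} {r : ℝ}, P.fstar μ.fst = r → _ :=
    fun hr => P.projObj_eq_coe hP.f_convex hP.f_differentiable hw hr
  have hmem := hk.mem_levelSet hP hne
  have hr' := hk.fstar_eq hP
  have hfy : ∀ {μ : WithLp 2 (E₁ × E₂)} {r : ℝ}, P.fstar μ.fst = r →
      0 ≤ r - (⟪μ.fst, w'⟫ - P.f w') := fun hr =>
    sub_nonneg.2 (P.inner_sub_le_of_fstar_le hr.le w')
  ext μ
  rw [Set.mem_singleton_iff]
  constructor
  · rintro ⟨hμ, hmin⟩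
    obtain ⟨r, hr, -, -⟩ := (Problem.mem_levelSet_iff hne).1 hμ
    have h1 : P.projObj μt wt μ ≤ P.projObj μt wt μ' := hmin hmem
    rw [hobj hr, hobj hr', EReal.coe_le_coe_iff] at h1
    have h2 := hk.growth hP hS hne (r := r) hμ
    have h3 := hfy hr
    have h4 : 0 ≤ ‖μ.snd - μ'.snd‖ ^ 2 := sq_nonneg _
    have h5 : ‖μ.snd - μ'.snd‖ ^ 2 = 0 := by linarith
    have h6 : r = ⟪μ.fst, w'⟫ - P.f w' := by linarith
    have h7 : μ.snd = μ'.snd := by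
      rw [pow_eq_zero_iff two_ne_zero, norm_eq_zero, sub_eq_zero] at h5
      exact h5
    have h8 : μ.fst = μ'.fst := by
      rw [hk.fst_eq]
      exact P.eq_gradient_of_fstar_eq hP.f_differentiable (hr.trans (by rw [h6]))
    exact WithLp.ofLp_injective 2 (Prod.ext h8 h7)
  · rintro rfl
    refine ⟨hmem, fun μ₁ hμ₁ => ?_⟩
    obtain ⟨r, hr, -, -⟩ := (Problem.mem_levelSet_iff hne).1 hμ₁
    change P.projObj μt wt μ ≤ P.projObj μt wt μ₁
    rw [hobj hr, hobj hr', EReal.coe_le_coe_iff]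
    have h2 := hk.growth hP hS hne (r := r) hμ₁
    have h3 := hfy hr
    have h4 : 0 ≤ ‖μ₁.snd - μ.snd‖ ^ 2 := sq_nonneg _
    linarith

end KKT

/-! ### Invariants along a run. -/

section Run

variable {E₁ E₂ : Type*} [NormedAddCommGroup E₁] [InnerProductSpace ℝ E₁] [CompleteSpace E₁]
  [NormedAddCommGroup E₂] [InnerProductSpace ℝ E₂] [CompleteSpace E₂]
  {P : Problem E₁ E₂}

lemma Problem.Standing.Kinit_nonempty (hP : P.Standing) : P.Kinit.Nonempty := by
  obtain ⟨x, -, y, hy, -⟩ := Set.mem_sub.1 (interior_subset hP.qualification)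
  obtain ⟨z, hz, -⟩ := hy
  exact convexHull_nonempty_iff.1 (closure_nonempty_iff.1 ⟨z, hz⟩)

variable [MeasurableSpace E₁] {lam : ℝ} {R : Iterates E₁ E₂} {T : ℕ∞}

lemma coe_le_of_succ_le {t : ℕ} (h : ((t + 1 : ℕ) : ℕ∞) ≤ T) : (t : ℕ∞) ≤ T :=
  le_trans (by exact_mod_cast Nat.le_succ t) h

lemma coe_lt_of_succ_le {t : ℕ} (h : ((t + 1 : ℕ) : ℕ∞) ≤ T) : (t : ℕ∞) < T :=
  lt_of_lt_of_le (by exact_mod_cast Nat.lt_succ_self t) h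

/-- Both updates preserve compactness: a pruned set is `Kinit` plus finitely many points, otherwise
one point is added. -/
lemma IsRun.cuts_of_Kprev (hP : P.Standing) (hR : IsRun P lam R T) {t : ℕ} (ht : (t : ℕ∞) ≤ T)
    (h : IsCompact (R.Kprev t) ∧ P.Kinit ⊆ R.Kprev t) :
    IsCompact (R.cuts t) ∧ P.Kinit ⊆ R.cuts t := by
  by_cases hp : ((R.gap t : ℝ) : EReal) < ((1 - lam : ℝ) : EReal) * R.gapRef t
  · obtain ⟨-, ⟨J, hJ, hJ'⟩, -, -⟩ := hR.prune t ht hp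
    rw [hJ']
    exact ⟨hP.Kinit_compact.union hJ.isCompact, Set.subset_union_left⟩
  · rw [(hR.no_prune t ht hp).1]
    exact ⟨h.1.union isCompact_singleton, h.2.trans Set.subset_union_left⟩

lemma IsRun.Kprev_compact (hP : P.Standing) (hR : IsRun P lam R T) (t : ℕ)
    (ht : (t : ℕ∞) ≤ T) : IsCompact (R.Kprev t) ∧ P.Kinit ⊆ R.Kprev t := by
  induction t with
  | zero =>
    rw [hR.init_cuts]
    exact ⟨hP.Kinit_compact, subset_rfl⟩
  | succ t ih =>
    have ht' := coe_le_of_succ_le ht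
    exact hR.cuts_of_Kprev hP ht' (ih ht')

lemma IsRun.cuts_compact (hP : P.Standing) (hR : IsRun P lam R T) {t : ℕ}
    (ht : (t : ℕ∞) ≤ T) : IsCompact (R.cuts t) ∧ (R.cuts t).Nonempty := by
  have h := hR.cuts_of_Kprev hP ht (hR.Kprev_compact hP t ht)
  exact ⟨h.1, hP.Kinit_nonempty.mono h.2⟩

lemma IsRun.w_mem_subdiff (hP : P.Standing) (hR : IsRun P lam R T) (t : ℕ)
    (ht : (t : ℕ∞) ≤ T) : R.w t ∈ subdiff P.fstar (R.μ t).fst := by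
  cases t with
  | zero => exact hR.init_w
  | succ t =>
    have ht' := coe_lt_of_succ_le ht
    rw [hR.w_succ t ht', hR.μ_succ t ht']
    exact P.mem_subdiff_fstar_gradient hP.f_convex hP.f_differentiable _

/-- A closed ball is closed and convex, so pruning inside the hull cannot leave it. -/
lemma IsRun.Kprev_subset_closedBall (hR : IsRun P lam R T) {C : ℝ}
    (hK : P.Kinit ⊆ Metric.closedBall 0 C)
    (hv : ∀ t : ℕ, (t : ℕ∞) ≤ T → -R.v t ∈ Metric.closedBall (0 : E₁) C) (t : ℕ)
    (ht : (t : ℕ∞) ≤ T) : R.Kprev t ⊆ Metric.closedBall 0 C := by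
  induction t with
  | zero => rwa [hR.init_cuts]
  | succ t ih =>
    have ht' := coe_le_of_succ_le ht
    have hu : R.Kprev t ∪ {-R.v t} ⊆ Metric.closedBall 0 C :=
      Set.union_subset (ih ht') (Set.singleton_subset_iff.2 (hv t ht'))
    by_cases hp : ((R.gap t : ℝ) : EReal) < ((1 - lam : ℝ) : EReal) * R.gapRef t
    · refine (hR.prune t ht' hp).1.trans ?_
      exact closure_minimal (convexHull_min hu (convex_closedBall 0 C)) Metric.isClosed_closedBall
    · exact (hR.no_prune t ht' hp).1.subset.trans hu

/-- With `M` the mass, the numerator `wt + ∫ v dν` has norm at most `D + C M ≤ (1 + M) D`, and it is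
divided by `1 + M`. -/
lemma norm_nextW_le {E₁ : Type*} [NormedAddCommGroup E₁] [InnerProductSpace ℝ E₁]
    [MeasurableSpace E₁] {S : Set E₁} {C D : ℝ} (hS : S ⊆ Metric.closedBall 0 C) (hCD : C ≤ D)
    {wt : E₁} (hw : ‖wt‖ ≤ D) {m : SignedMeasure S} (hm : m ≤ 0) :
    ‖Problem.nextW wt S m‖ ≤ D := by
  obtain ⟨ν, _, rfl⟩ := exists_eq_neg_toSignedMeasure hm
  have hM : 0 < 1 + ν.real Set.univ := by positivity
  have hx : ‖∫ v, (v : E₁) ∂ν‖ ≤ C * ν.real Set.univ :=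
    norm_integral_le_of_norm_le_const (Filter.Eventually.of_forall fun v =>
      mem_closedBall_zero_iff.1 (hS v.2))
  have hC : C * ν.real Set.univ ≤ D * ν.real Set.univ :=
    mul_le_mul_of_nonneg_right hCD measureReal_nonneg
  rw [Problem.nextW_neg_toSignedMeasure, norm_smul, norm_inv, Real.norm_of_nonneg hM.le,
    inv_mul_le_iff₀ hM]
  have := norm_add_le (∫ v, (v : E₁) ∂ν) wt
  linarith

lemma IsRun.norm_w_le (hR : IsRun P lam R T) {C D : ℝ}
    (hK : P.Kinit ⊆ Metric.closedBall 0 C)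
    (hv : ∀ t : ℕ, (t : ℕ∞) ≤ T → -R.v t ∈ Metric.closedBall (0 : E₁) C) (hCD : C ≤ D)
    (h0 : ‖R.w 0‖ ≤ D) (t : ℕ) (ht : (t : ℕ∞) ≤ T) : ‖R.w t‖ ≤ D := by
  induction t with
  | zero => exact h0
  | succ t ih =>
    have ht' := coe_lt_of_succ_le ht
    rw [hR.w_succ t ht']
    exact norm_nextW_le (hR.Kprev_subset_closedBall hK hv (t + 1) ht) hCD (ih ht'.le)
      (hR.candidate t ht').1

end Run

end DLS

theorem mainTheorem5 {E₁ E₂ : Type*}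
    [NormedAddCommGroup E₁] [InnerProductSpace ℝ E₁] [CompleteSpace E₁]
    [NormedAddCommGroup E₂] [InnerProductSpace ℝ E₂] [CompleteSpace E₂]
    [MeasurableSpace E₁] [BorelSpace E₁]
    (P : Problem E₁ E₂) (hP : P.Standing) (lam : ℝ) (R : Iterates E₁ E₂) (T : ℕ∞)
    (hR : IsRun P lam R T) :
    (∀ t : ℕ, (t : ℕ∞) ≤ T → ∀ μt wt S ℓ, μt = R.μ t → wt = R.w t → S = R.cuts t →
      ℓ = R.level lam t →
      ∀ m : SignedMeasure S, m ∈ argminOn (P.explObj μt wt S ℓ) {m | m ≤ 0} →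
      -- up to the shift, the projection problem is `minimize F p + G (L p)`
      ((⨅ p, fenchelPrimalObj (P.primalF μt wt) (primalG S ℓ) (P.primalL S) p)
          = (⨅ μ ∈ P.levelSet S ℓ, P.projObj μt wt μ) + (P.shift μt wt : EReal)
        ∧ (∀ μ z, (μ, z) ∈ argminOn
              (fenchelPrimalObj (P.primalF μt wt) (primalG S ℓ) (P.primalL S)) Set.univ ↔
            (z : EReal) = P.fstar μ.fst ∧ μ ∈ argminOn (P.projObj μt wt) (P.levelSet S ℓ))
      -- the Fenchel dual of `minimize F p + G (L p)` is the explicit measure-valued problem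
        ∧ (∀ m' : SignedMeasure S, ∃ φ : StrongDual ℝ C(S, ℝ), Represents φ m')
        ∧ (∀ (φ : StrongDual ℝ C(S, ℝ)) (m₁ m₂ : SignedMeasure S),
            Represents φ m₁ → Represents φ m₂ → m₁ = m₂)
        ∧ (∀ (φ : StrongDual ℝ C(S, ℝ)) (m' : SignedMeasure S), Represents φ m' →
            fenchelDualObj (P.primalF μt wt) (primalG S ℓ) (P.primalL S) φ
              = P.explObj μt wt S ℓ m' + ind {m | m ≤ 0} m')
        ∧ (∀ φ : StrongDual ℝ C(S, ℝ),
            fenchelDualObj (P.primalF μt wt) (primalG S ℓ) (P.primalL S) φ ≠ ⊤ →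
            ∃ m' : SignedMeasure S, m' ≤ 0 ∧ Represents φ m')
      -- the two values are opposite, up to the shift
        ∧ (⨅ m' ∈ {m : SignedMeasure S | m ≤ 0}, P.explObj μt wt S ℓ m')
            = -((⨅ μ ∈ P.levelSet S ℓ, P.projObj μt wt μ) + (P.shift μt wt : EReal)))
      -- the updates solve the projection problem
      ∧ argminOn (P.projObj μt wt) (P.levelSet S ℓ) = {P.nextMu μt wt S m}
      -- and satisfy the subgradient and normal cone conditions
      ∧ Problem.nextW wt S m ∈ subdiff P.fstar (P.nextMu μt wt S m).fst
      ∧ WithLp.toLp 2 (wt - Problem.nextW wt S m, μt.snd - (P.nextMu μt wt S m).snd)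
          ∈ normalCone (P.levelSet S ℓ) (P.nextMu μt wt S m)) ∧
    (OracleAssumption P R T → ∃ C : ℝ, ∀ t : ℕ, (t : ℕ∞) ≤ T → ‖R.w t‖ ≤ C) := by
  refine ⟨?_, ?_⟩
  · rintro t ht μt wt S ℓ hμt hwt hSt hℓ m hm
    obtain ⟨hS, hne⟩ : IsCompact S ∧ S.Nonempty := hSt ▸ hR.cuts_compact hP ht
    have hw : wt ∈ subdiff P.fstar μt.fst := by
      rw [hμt, hwt]
      exact hR.w_mem_subdiff hP t ht
    have hinf := iInf_mem_eq_of_mem_argminOn hm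
    obtain ⟨ν, _, rfl⟩ := exists_eq_neg_toSignedMeasure hm.1
    obtain ⟨r, hk⟩ := P.kkt_of_mem_argminOn hP hS hm
    have hmem := hk.mem_levelSet hP hne
    have harg := hk.argminOn_projObj hP hw hS hne
    have hmin : P.nextMu μt wt S (-ν.toSignedMeasure)
        ∈ argminOn (P.projObj μt wt) (P.levelSet S ℓ) := harg ▸ Set.mem_singleton _
    have hiff := mem_argminOn_primalObj_iff hP.f_convex hP.f_differentiable hw hne ⟨_, hmem⟩
    refine ⟨⟨?_, hiff, exists_represents hS, fun φ m₁ m₂ => represents_unique hS,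
      fun φ m' h => fenchelDualObj_eq_explObj hP μt wt hS ℓ h,
      fun φ h => exists_represents_of_dualObj_ne_top hP hS h, ?_⟩, harg, ?_, hmem, ?_⟩
    · rw [iInf_mem_eq_of_mem_argminOn hmin,
        iInf_eq_of_mem_argminOn_univ ((hiff _ r).2 ⟨(hk.fstar_eq hP).symm, hmin⟩),
        primalObj_eq_projObj_add_shift hP.f_convex hP.f_differentiable hw hne
          (hk.fstar_eq hP) hmem]
    · rw [iInf_mem_eq_of_mem_argminOn hmin, hinf, hk.explObj_eq hP hw]
    · exact P.mem_subdiff_fstar_gradient hP.f_convex hP.f_differentiable _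
    · exact fun μ hμ => hk.inner_le_zero hP hS hne hμ
  · rintro ⟨-, C₁, hC₁⟩
    obtain ⟨C₀, hC₀⟩ := hP.Kinit_compact.isBounded.exists_norm_le
    -- The inner maximum is the radius of a ball containing all cuts; the outer one also accounts
    -- for the starting point.
    refine ⟨max (max C₀ C₁) ‖R.w 0‖, fun t ht => hR.norm_w_le (C := max C₀ C₁) ?_ ?_
      (le_max_left _ _) (le_max_right _ _) t ht⟩
    · exact fun x hx => mem_closedBall_zero_iff.2 ((hC₀ x hx).trans (le_max_left _ _))
    · intro t ht
      rw [mem_closedBall_zero_iff, norm_neg]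
      exact (WithLp.norm_fst_le (x := WithLp.toLp 2 (R.v t, P.A (R.v t)))).trans
        ((hC₁ t ht).trans (le_max_right _ _))
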